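/- Let $\bar M$ be a smooth compact Hausdorff 3-manifold with boundary, every connected component of which meets $\partial M$ (for instance, $\bar M$ connected with $\partial M\neq\emptyset$), and let $M$ be its interior. Fix a smooth defining function $\rho\colon\bar M\to[0,\infty)$, that is, $\rho^{-1}(0)=\partial M$ and $d\rho\neq 0$ along $\partial M$; a smooth Riemannian metric $\bar h$ on $\bar M$ with $|d\rho|_{\bar h}=1$ along $\partial M$; and put $h=\rho^{-2}\bar h$. Let $\bar\nabla$ be the Levi-Civita connection of $\bar h$. For a tensor field $u$ on $M$ of covariant rank $p$ and contravariant rank $q$, let $r=p-q$ be its weight. Let $C^{k,\alpha}_\delta(M)=\rho^\delta C^{k,\alpha}(M)$ be the weighted H\"older space with norms taken with respect to $h$. Explicitly, $u\in C^{k,\alpha}_\delta(M)$ means that $u$ is $C^k$ on $M$ and that in each smooth chart of $\bar M$ (valued in the half space $\{x_0\ge 0\}$) the coordinate components $u_a$ of $u$ satisfy, for every compact subset $K$ of the domain of the chart, with a constant $C=C(K)$, $$|\partial^j u_a(x)|\le C\rho(x)^{\delta-r-j}\quad(0\le j\le k),\qquad |\partial^k u_a(x)-\partial^k u_a(y)|\le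 C\rho(x)^{\delta-r-k-\alpha}|x-y|^\alpha\quad\text{if } |x-y|\le \tfrac12 x_0,$$ for all $x,y\in K\cap M$. Let $\mathscr M_{\mathrm{weak}}^{k,\alpha;1}$ $(k\ge 1)$ be the set of Riemannian metrics $\lambda$ on $M$ such that $\bar\lambda=\rho^2\lambda$ satisfies $\bar\lambda\in C^{k,\alpha}_2(M)$ and $\bar\nabla\bar\lambda\in C^{k-1,\alpha}_3(M)$, and such that $\bar\lambda$ extends continuously to a (nondegenerate) Riemannian metric on $\bar M$ with $|d\rho|_{\bar\lambda}=1$ along $\partial M$. Lemma. Let $\alpha\in(0,1)$ and $\delta>1$, and suppose $\lambda\in\mathscr M_{\mathrm{weak}}^{3,\alpha;1}$. Let $X\in C^{3,\alpha}_\delta(M)$ be a conformal Killing vector field on $(M,\lambda)$, i.e. $\tfrac12\mathcal L_X\lambda-\tfrac13(\operatorname{div}_\lambda X)\lambda=0$ on $M$. Then $X$ vanishes identically on $M$. -/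

import Mathlib

open scoped Manifold ContDiff Topology

noncomputable section

namespace WeakAH

/-- The model vector space `ℝ³`; coordinates are indexed by `0, 1, 2`. -/
abbrev E3 : Type := EuclideanSpace ℝ (Fin 3)

/-- The model half space `{x ∈ ℝ³ | 0 ≤ x 0}` of three-manifolds with boundary. -/
abbrev H3 : Type := EuclideanHalfSpace 3

section Charts

variable {Mbar : Type*} [TopologicalSpace Mbar] [ChartedSpace H3 Mbar]

/-- A field of bilinear forms on the tangent spaces (a covariant 2-tensor field). -/
abbrev BilinField (Mbar : Type*) [TopologicalSpace Mbar] [ChartedSpace H3 Mbar] : Type _ :=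
  ∀ p : Mbar, TangentSpace (𝓡∂ 3) p →L[ℝ] TangentSpace (𝓡∂ 3) p →L[ℝ] ℝ

/-- A vector field. -/
abbrev VField (Mbar : Type*) [TopologicalSpace Mbar] [ChartedSpace H3 Mbar] : Type _ :=
  ∀ p : Mbar, TangentSpace (𝓡∂ 3) p

/-- The coordinate expression of `M` (the interior of `Mbar`) in the chart `e`: those points of
the image of the chart that lie in the open half space. It is an open subset of `ℝ³`. -/
def chartInterior (e : OpenPartialHomeomorph Mbar H3) : Set E3 :=
  {x | x ∈ (e.extend (𝓡∂ 3)).target ∧ 0 < x 0}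

/-- The point of the manifold with coordinates `x` in the chart `e`. -/
def chartPoint (e : OpenPartialHomeomorph Mbar H3) (x : E3) : Mbar :=
  (e.extend (𝓡∂ 3)).symm x

/-- The coordinate vector field `∂ᵢ` of the chart `e`, at the point with coordinates `x`. -/
def coordVec (e : OpenPartialHomeomorph Mbar H3) (x : E3) (i : Fin 3) :
    TangentSpace (𝓡∂ 3) (chartPoint e x) :=
  mfderivWithin 𝓘(ℝ, E3) (𝓡∂ 3) (e.extend (𝓡∂ 3)).symm (Set.range (𝓡∂ 3)) x
    (EuclideanSpace.single i (1 : ℝ) : E3)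

/-- The component `Xⁱ` of the vector field `X` in the chart `e`, as a function of the
coordinates. -/
def vecComp (X : VField Mbar) (e : OpenPartialHomeomorph Mbar H3) (i : Fin 3) (x : E3) : ℝ :=
  let v : E3 := mfderiv (𝓡∂ 3) 𝓘(ℝ, E3) (e.extend (𝓡∂ 3)) (chartPoint e x) (X (chartPoint e x))
  v i

/-- The matrix of components `b i j` of a covariant 2-tensor field in the chart `e`, as a function
of the coordinates. -/
def bilinComp (b : BilinField Mbar) (e : OpenPartialHomeomorph Mbar H3) (x : E3) :
    Matrix (Fin 3) (Fin 3) ℝ :=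
  Matrix.of fun i j => b (chartPoint e x) (coordVec e x i) (coordVec e x j)

end Charts

/-- The coordinate partial derivative `∂ₖ f` on `ℝ³`. -/
def pd (k : Fin 3) (f : E3 → ℝ) (x : E3) : ℝ :=
  fderiv ℝ f x (EuclideanSpace.single k (1 : ℝ))

/-- The Christoffel symbol `Γˡₖᵢ` of the metric with component matrix `G` on `ℝ³`. -/
def christoffel (G : E3 → Matrix (Fin 3) (Fin 3) ℝ) (l k i : Fin 3) (x : E3) : ℝ :=
  (1 / 2) * ∑ m, (G x)⁻¹ l m *
    (pd k (fun y => G y m i) x + pd i (fun y => G y k m) x - pd m (fun y => G y k i) x)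

/-- The components `(∇u)ₖᵢⱼ` of the covariant derivative of the covariant 2-tensor `u` with
respect to the Levi-Civita connection of the metric `G`. -/
def covDeriv2 (G u : E3 → Matrix (Fin 3) (Fin 3) ℝ) (k i j : Fin 3) (x : E3) : ℝ :=
  pd k (fun y => u y i j) x - ∑ l, christoffel G l k i x * u x l j
    - ∑ l, christoffel G l k j x * u x i l

/-- The components of the Lie derivative `𝓛_X G`. -/
def lieMetric (G : E3 → Matrix (Fin 3) (Fin 3) ℝ) (X : Fin 3 → E3 → ℝ) (i j : Fin 3)
    (x : E3) : ℝ :=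
  ∑ k, (X k x * pd k (fun y => G y i j) x + G x k j * pd i (X k) x + G x i k * pd j (X k) x)

/-- The divergence `∇ᵢ Xⁱ` with respect to the Levi-Civita connection of `G`. -/
def divergence (G : E3 → Matrix (Fin 3) (Fin 3) ℝ) (X : Fin 3 → E3 → ℝ) (x : E3) : ℝ :=
  ∑ i, (pd i (X i) x + ∑ k, christoffel G i i k x * X k x)

/-- The components of the conformal Killing (Ahlfors) operator
`𝓓_G X = ½ 𝓛_X G - ⅓ (div_G X) G` in dimension three. -/
def conformalKillingOp (G : E3 → Matrix (Fin 3) (Fin 3) ℝ) (X : Fin 3 → E3 → ℝ) (i j : Fin 3)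
    (x : E3) : ℝ :=
  (1 / 2) * lieMetric G X i j x - (1 / 3) * divergence G X x * G x i j

section Manifold

variable {Mbar : Type*} [TopologicalSpace Mbar] [ChartedSpace H3 Mbar] [IsManifold (𝓡∂ 3) ∞ Mbar]

/-- `X` is a conformal Killing vector field of the metric `g` on `M`: `𝓓_g X = 0` on `M`, in every
smooth chart. -/
def IsConformalKilling (g : BilinField Mbar) (X : VField Mbar) : Prop :=
  ∀ e ∈ IsManifold.maximalAtlas (𝓡∂ 3) ∞ Mbar, ∀ x ∈ chartInterior e, ∀ i j : Fin 3,
    conformalKillingOp (bilinComp g e) (vecComp X e) i j x = 0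

/-- `ρ` is a smooth defining function for the boundary of `Mbar`. -/
structure IsDefiningFunction (ρ : Mbar → ℝ) : Prop where
  smooth : ContMDiff (𝓡∂ 3) 𝓘(ℝ, ℝ) ∞ ρ
  nonneg : ∀ p, 0 ≤ ρ p
  zero_iff : ∀ p, ρ p = 0 ↔ p ∈ (𝓡∂ 3).boundary Mbar
  mfderiv_ne_zero : ∀ p ∈ (𝓡∂ 3).boundary Mbar, mfderiv (𝓡∂ 3) 𝓘(ℝ, ℝ) ρ p ≠ 0

/-- A smooth Riemannian metric on `Mbar` (smooth up to the boundary). -/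
abbrev SmoothMetric (Mbar : Type*) [TopologicalSpace Mbar] [ChartedSpace H3 Mbar]
    [IsManifold (𝓡∂ 3) ∞ Mbar] : Type _ :=
  Bundle.ContMDiffRiemannianMetric (𝓡∂ 3) ∞ E3 (fun p : Mbar => TangentSpace (𝓡∂ 3) p)

/-- A continuous Riemannian metric on `Mbar` (continuous up to the boundary). -/
abbrev ContinuousMetric (Mbar : Type*) [TopologicalSpace Mbar] [ChartedSpace H3 Mbar]
    [IsManifold (𝓡∂ 3) ∞ Mbar] : Type _ :=
  Bundle.ContinuousRiemannianMetric E3 (fun p : Mbar => TangentSpace (𝓡∂ 3) p)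

/-- The norm `|dρ|` of the differential of `ρ` at `p`, dual to the inner product `b` on the tangent
space at `p`. -/
def dNorm (ρ : Mbar → ℝ) (p : Mbar)
    (b : TangentSpace (𝓡∂ 3) p →L[ℝ] TangentSpace (𝓡∂ 3) p →L[ℝ] ℝ) : ℝ :=
  sSup {t : ℝ | ∃ v : TangentSpace (𝓡∂ 3) p, b v v ≤ 1 ∧
    t = (mfderiv (𝓡∂ 3) 𝓘(ℝ, ℝ) ρ p v : ℝ)}

/-- Membership in the weighted Hölder space `C^{k,α}_δ(M) = ρ^δ C^{k,α}(M)` for a tensor field of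
weight `r` (covariant rank minus contravariant rank), given by its component functions `comp e a`
in the smooth charts `e`, where `a` ranges over the multi-indices.

Norms are those of the metric `h = ρ⁻² hbar`: for coordinates on `Mbar` smooth up to the boundary,
the components of a tensor in an `h`-orthonormal frame are `ρ^r` times its coordinate components,
and a unit of `h`-length is `ρ` times a coordinate unit. So, locally uniformly up to the boundary,
one requires
`|∂^j u| ≤ C ρ^(δ - r - j)` for `j ≤ k`, together with the Hölder bound
`|∂^k u (x) - ∂^k u (y)| ≤ C ρ(x)^(δ - r - k - α) |x - y|^α` on the balls `|x - y| ≤ x₀ / 2`, which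
have `h`-radius comparable to one near the boundary (`x₀` is the coordinate vanishing at the
boundary). These are the Hölder norms of `ρ^(-δ) u` in the rescaled (Möbius) coordinates
`z ↦ x + x₀ z`. Since `Mbar` is compact, the uniformity is expressed by taking arbitrary compact
subsets `K` of chart domains of `Mbar`; the condition does not depend on `hbar`. -/
def MemWeightedHolder {ι : Type*} (ρ : Mbar → ℝ) (r : ℝ) (k : ℕ) (α δ : ℝ)
    (comp : OpenPartialHomeomorph Mbar H3 → ι → E3 → ℝ) : Prop :=
  ∀ e ∈ IsManifold.maximalAtlas (𝓡∂ 3) ∞ Mbar, ∀ a : ι,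
    ContDiffOn ℝ k (comp e a) (chartInterior e) ∧
    ∀ K : Set Mbar, IsCompact K → K ⊆ e.source →
      ∃ C : ℝ, ∀ x ∈ chartInterior e, chartPoint e x ∈ K →
        (∀ j : ℕ, j ≤ k →
          ‖iteratedFDeriv ℝ j (comp e a) x‖ ≤ C * ρ (chartPoint e x) ^ (δ - r - (j : ℝ))) ∧
        ∀ y ∈ chartInterior e, chartPoint e y ∈ K → dist x y ≤ x 0 / 2 →
          ‖iteratedFDeriv ℝ k (comp e a) x - iteratedFDeriv ℝ k (comp e a) y‖ ≤
            C * ρ (chartPoint e x) ^ (δ - r - (k : ℝ) - α) * dist x y ^ α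

/-- `X ∈ C^{k,α}_δ(M)` for a vector field `X` (weight `-1`). -/
def VectorHolder (ρ : Mbar → ℝ) (k : ℕ) (α δ : ℝ) (X : VField Mbar) : Prop :=
  MemWeightedHolder ρ (-1) k α δ (vecComp X)

/-- The conformal compactification `gbar = ρ² g`. -/
def compactify (ρ : Mbar → ℝ) (g : BilinField Mbar) : BilinField Mbar :=
  fun p => (ρ p ^ 2) • g p

/-- `u ∈ 𝒞^{k,α;1}(M)` for a covariant 2-tensor field `u` (weight `r = 2`), where `k ≥ 1`:
`u ∈ C^{k,α}_r(M)` and `∇bar u ∈ C^{k-1,α}_{r+1}(M)`, where `∇bar` is the Levi-Civita connection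
of `hbar` (so that `∇bar u` has weight `3`). -/
def MemScriptC1 (ρ : Mbar → ℝ) (hbar : SmoothMetric Mbar) (k : ℕ) (α : ℝ)
    (u : BilinField Mbar) : Prop :=
  MemWeightedHolder ρ 2 k α 2
      (fun e (a : Fin 3 × Fin 3) x => bilinComp u e x a.1 a.2) ∧
  MemWeightedHolder ρ 3 (k - 1) α 3
      (fun e (a : Fin 3 × Fin 3 × Fin 3) =>
        covDeriv2 (bilinComp hbar.inner e) (bilinComp u e) a.1 a.2.1 a.2.2)

/-- `g ∈ 𝓜_weak^{k,α;1}`, for `k ≥ 1`: `g` is a weakly `C^{k,α}` asymptotically hyperbolic metric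
on the interior `M` of `Mbar`. Only the values of `g` on `M` matter. -/
structure IsWeaklyAH (ρ : Mbar → ℝ) (hbar : SmoothMetric Mbar) (k : ℕ) (α : ℝ)
    (g : BilinField Mbar) : Prop where
  /-- `g` is a Riemannian metric on `M`. -/
  symm : ∀ p ∈ (𝓡∂ 3).interior Mbar, ∀ v w, g p v w = g p w v
  pos : ∀ p ∈ (𝓡∂ 3).interior Mbar, ∀ v, v ≠ 0 → 0 < g p v v
  /-- `ρ² g ∈ 𝒞^{k,α;1}(M)`. -/
  regular : MemScriptC1 ρ hbar k α (compactify ρ g)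
  /-- `ρ² g` extends continuously to a metric (so nondegenerate) on `Mbar`, in which
  `|dρ| = 1` along the boundary. -/
  extends_to_boundary : ∃ G : ContinuousMetric Mbar,
    (∀ p ∈ (𝓡∂ 3).interior Mbar, G.inner p = compactify ρ g p) ∧
    ∀ p ∈ (𝓡∂ 3).boundary Mbar, dNorm ρ p (G.inner p) = 1

end Manifold

end WeakAH

end

/-!
Unique continuation for conformal Killing fields from the boundary at infinity.

The conformal Killing equation is conformally invariant, so `X` is a conformal Killing field of the
compactified metric `g = ρ² λ`, which has bounded first derivatives up to the boundary, while its
second and third derivatives are `O(ρ⁻¹)` and `O(ρ⁻²)`. All estimates are made in a chart, with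
coordinate derivatives.

The equation `𝓛_X g = φ g` is of finite type: differentiated twice, it determines all third
derivatives of `X` in terms of lower order ones. Permuting indices as in the derivation of the
Christoffel symbols expresses `∂³X` through `∂²φ`, and the symmetry of `∂³X` then gives a linear
system for `∂²φ` which is invertible in dimension three (`conformalKilling_symbol_bound`). Keeping
track of the derivatives of `g`, one gets near every point
`|∂³X| ≤ C (|∂²X| + ρ⁻¹ |∂X| + ρ⁻² |X|)` (`exists_third_derivative_bound`,
`exists_local_third_derivative_bound`).

This inequality is scale invariant up to a factor `ρ`: on a ray issuing from a boundary point on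
which `∂ʲX = O(t^(s + 2 - j))` for `j ≤ 2`, with `s > 0`, three integrations improve the constant in
these bounds by a factor `O(T)`, `T` being the length of the ray, so `X` vanishes on short rays
(`eq_zero_along_ray`). The hypothesis `X ∈ C^{3,α}_δ` gives such a decay with `s = δ - 1`, so `X`
vanishes near the boundary (`exists_halfBall_eq_zero_of_boundary`). The same argument on rays
issuing from a point near which `X` vanishes gives unique continuation in the interior
(`exists_ball_unique_continuation`). Hence the set of points near which `X` vanishes is open, closed
and contains the boundary, so that it contains every component.
-/

noncomputable section

namespace WeakAH

/-! ### Coordinate partial derivatives -/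

theorem contDiffOn_pd {n : ℕ} {U : Set E3} (hU : IsOpen U) {f : E3 → ℝ}
    (hf : ContDiffOn ℝ (n + 1 : ℕ) f U) (k : Fin 3) : ContDiffOn ℝ n (pd k f) U :=
  (hf.fderiv_of_isOpen hU (by norm_cast)).clm_apply contDiffOn_const

theorem pd_congr {f g : E3 → ℝ} {x : E3} (h : f =ᶠ[𝓝 x] g) (k : Fin 3) : pd k f x = pd k g x := by
  simp only [pd, h.fderiv_eq]

theorem pd_congr_of_isOpen {U : Set E3} (hU : IsOpen U) {f g : E3 → ℝ} (h : Set.EqOn f g U)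
    (k : Fin 3) : Set.EqOn (pd k f) (pd k g) U := fun _ hx =>
  pd_congr (h.eventuallyEq_of_mem (hU.mem_nhds hx)) k

theorem pd_add {f g : E3 → ℝ} {x : E3} (hf : DifferentiableAt ℝ f x)
    (hg : DifferentiableAt ℝ g x) (k : Fin 3) :
    pd k (fun y => f y + g y) x = pd k f x + pd k g x := by
  simp [pd, fderiv_fun_add hf hg]

theorem pd_mul {f g : E3 → ℝ} {x : E3} (hf : DifferentiableAt ℝ f x)
    (hg : DifferentiableAt ℝ g x) (k : Fin 3) :
    pd k (fun y => f y * g y) x = pd k f x * g x + f x * pd k g x := by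
  simp [pd, fderiv_fun_mul hf hg]; ring

theorem pd_sum {ι : Type*} {s : Finset ι} {f : ι → E3 → ℝ} {x : E3}
    (hf : ∀ a ∈ s, DifferentiableAt ℝ (f a) x) (k : Fin 3) :
    pd k (fun y => ∑ a ∈ s, f a y) x = ∑ a ∈ s, pd k (f a) x := by
  simp [pd, fderiv_fun_sum hf]

theorem pd_pd_eq_fderiv_fderiv {f : E3 → ℝ} {x : E3} (hf : ContDiffAt ℝ 2 f x) (i j : Fin 3) :
    pd i (pd j f) x =
      fderiv ℝ (fderiv ℝ f) x (EuclideanSpace.single i 1) (EuclideanSpace.single j 1) := by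
  have hd : DifferentiableAt ℝ (fderiv ℝ f) x :=
    (hf.fderiv_right (m := 1) (by norm_num)).differentiableAt (by norm_num)
  change fderiv ℝ (fun y => fderiv ℝ f y (EuclideanSpace.single j 1)) x _ = _
  rw [fderiv_clm_apply hd (differentiableAt_const _)]
  simp

theorem pd_comm {f : E3 → ℝ} {x : E3} (hf : ContDiffAt ℝ 2 f x) (i j : Fin 3) :
    pd i (pd j f) x = pd j (pd i f) x := by
  rw [pd_pd_eq_fderiv_fderiv hf, pd_pd_eq_fderiv_fderiv hf]
  exact (hf.isSymmSndFDerivAt (by simp)).eq _ _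

theorem abs_apply_le_norm_iteratedFDeriv (f : E3 → ℝ) (x : E3) :
    |f x| ≤ ‖iteratedFDeriv ℝ 0 f x‖ := by
  rw [norm_iteratedFDeriv_zero, Real.norm_eq_abs]

theorem abs_pd_le_norm_iteratedFDeriv (f : E3 → ℝ) (x : E3) (i : Fin 3) :
    |pd i f x| ≤ ‖iteratedFDeriv ℝ 1 f x‖ := by
  have h := (iteratedFDeriv ℝ 1 f x).le_opNorm fun _ => EuclideanSpace.single i (1 : ℝ)
  rw [iteratedFDeriv_one_apply] at h
  simpa [pd] using h

theorem abs_pd_pd_le_norm_iteratedFDeriv {f : E3 → ℝ} {x : E3} (hf : ContDiffAt ℝ 2 f x)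
    (i j : Fin 3) : |pd i (pd j f) x| ≤ ‖iteratedFDeriv ℝ 2 f x‖ := by
  have h := (iteratedFDeriv ℝ 2 f x).le_opNorm
    ![EuclideanSpace.single i (1 : ℝ), EuclideanSpace.single j (1 : ℝ)]
  rw [iteratedFDeriv_two_apply] at h
  rw [pd_pd_eq_fderiv_fderiv hf]
  simpa [Fin.prod_univ_two] using h

theorem pd_pd_add {U : Set E3} (hU : IsOpen U) {f g : E3 → ℝ} (hf : ContDiffOn ℝ 2 f U)
    (hg : ContDiffOn ℝ 2 g U) (i j : Fin 3) {x : E3} (hx : x ∈ U) :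
    pd i (pd j fun y => f y + g y) x = pd i (pd j f) x + pd i (pd j g) x := by
  have h1 : Set.EqOn (pd j fun y => f y + g y) (fun y => pd j f y + pd j g y) U := fun y hy =>
    pd_add ((hf.contDiffAt (hU.mem_nhds hy)).differentiableAt (by norm_num))
      ((hg.contDiffAt (hU.mem_nhds hy)).differentiableAt (by norm_num)) j
  have hf' := contDiffOn_pd (n := 1) hU hf j
  have hg' := contDiffOn_pd (n := 1) hU hg j
  rw [pd_congr_of_isOpen hU h1 i hx, pd_add
    ((hf'.contDiffAt (hU.mem_nhds hx)).differentiableAt (by norm_num))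
      ((hg'.contDiffAt (hU.mem_nhds hx)).differentiableAt (by norm_num)) i]

theorem pd_pd_mul {U : Set E3} (hU : IsOpen U) {f g : E3 → ℝ} (hf : ContDiffOn ℝ 2 f U)
    (hg : ContDiffOn ℝ 2 g U) (i j : Fin 3) {x : E3} (hx : x ∈ U) :
    pd i (pd j fun y => f y * g y) x =
      pd i (pd j f) x * g x + pd j f x * pd i g x + (pd i f x * pd j g x + f x * pd i (pd j g) x) := by
  have d0 : ∀ {f : E3 → ℝ}, ContDiffOn ℝ 2 f U → ∀ y ∈ U, DifferentiableAt ℝ f y :=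
    fun h y hy => (h.contDiffAt (hU.mem_nhds hy)).differentiableAt (by norm_num)
  have d1 : ∀ {f : E3 → ℝ}, ContDiffOn ℝ 2 f U → ∀ y ∈ U, DifferentiableAt ℝ (pd j f) y :=
    fun h y hy => ((contDiffOn_pd (n := 1) hU h j).contDiffAt
      (hU.mem_nhds hy)).differentiableAt (by norm_num)
  have h1 : Set.EqOn (pd j fun y => f y * g y) (fun y => pd j f y * g y + f y * pd j g y) U :=
    fun y hy => pd_mul (d0 hf y hy) (d0 hg y hy) j
  rw [pd_congr_of_isOpen hU h1 i hx,
    pd_add ((d1 hf x hx).fun_mul (d0 hg x hx)) ((d0 hf x hx).fun_mul (d1 hg x hx)),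
    pd_mul (d1 hf x hx) (d0 hg x hx), pd_mul (d0 hf x hx) (d1 hg x hx)]

theorem pd_pd_sum {U : Set E3} (hU : IsOpen U) {ι : Type*} {s : Finset ι} {f : ι → E3 → ℝ}
    (hf : ∀ a ∈ s, ContDiffOn ℝ 2 (f a) U) (i j : Fin 3) {x : E3} (hx : x ∈ U) :
    pd i (pd j fun y => ∑ a ∈ s, f a y) x = ∑ a ∈ s, pd i (pd j (f a)) x := by
  have h1 : Set.EqOn (pd j fun y => ∑ a ∈ s, f a y) (fun y => ∑ a ∈ s, pd j (f a) y) U :=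
    fun y hy => pd_sum (fun a ha => ((hf a ha).contDiffAt
      (hU.mem_nhds hy)).differentiableAt (by norm_num)) j
  rw [pd_congr_of_isOpen hU h1 i hx, pd_sum (fun a ha => ((contDiffOn_pd (n := 1) hU (hf a ha)
    j).contDiffAt (hU.mem_nhds hx)).differentiableAt (by norm_num)) i]

/-! ### Functions with scale-invariant bounds on two derivatives -/

/-- `f` is `C²` on `U`, and `f`, `τ ∂f`, `τ² ∂²f` are bounded there. With `τ` the distance to the
boundary this is the space of functions that are uniformly `C²` in rescaled coordinates. -/
def ScaledBound (U : Set E3) (τ : E3 → ℝ) (f : E3 → ℝ) : Prop :=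
  ContDiffOn ℝ 2 f U ∧ ∃ C : ℝ, ∀ x ∈ U, |f x| ≤ C ∧ (∀ i, τ x * |pd i f x| ≤ C) ∧
    ∀ i j, τ x ^ 2 * |pd i (pd j f) x| ≤ C

theorem ScaledBound.add {U : Set E3} (hU : IsOpen U) {τ : E3 → ℝ} (hτ : ∀ x ∈ U, 0 ≤ τ x)
    {f g : E3 → ℝ} (hf : ScaledBound U τ f) (hg : ScaledBound U τ g) :
    ScaledBound U τ (fun x => f x + g x) := by
  obtain ⟨hf, A, hA⟩ := hf
  obtain ⟨hg, B, hB⟩ := hg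
  refine ⟨hf.add hg, A + B, fun x hx => ?_⟩
  obtain ⟨a0, a1, a2⟩ := hA x hx
  obtain ⟨b0, b1, b2⟩ := hB x hx
  have ht := hτ x hx
  refine ⟨(abs_add_le _ _).trans (add_le_add a0 b0), fun i => ?_, fun i j => ?_⟩
  · rw [pd_add ((hf.contDiffAt (hU.mem_nhds hx)).differentiableAt (by norm_num))
      ((hg.contDiffAt (hU.mem_nhds hx)).differentiableAt (by norm_num)) i]
    calc _ ≤ τ x * (|pd i f x| + |pd i g x|) := by gcongr; exact abs_add_le _ _
      _ ≤ _ := by linarith [a1 i, b1 i]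
  · rw [pd_pd_add hU hf hg i j hx]
    calc _ ≤ τ x ^ 2 * (|pd i (pd j f) x| + |pd i (pd j g) x|) := by
          gcongr; exact abs_add_le _ _
      _ ≤ _ := by linarith [a2 i j, b2 i j]

theorem ScaledBound.mul {U : Set E3} (hU : IsOpen U) {τ : E3 → ℝ} (hτ : ∀ x ∈ U, 0 ≤ τ x)
    {f g : E3 → ℝ} (hf : ScaledBound U τ f) (hg : ScaledBound U τ g) :
    ScaledBound U τ (fun x => f x * g x) := by
  obtain ⟨hf, A, hA⟩ := hf
  obtain ⟨hg, B, hB⟩ := hg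
  refine ⟨hf.mul hg, 4 * (A * B), fun x hx => ?_⟩
  obtain ⟨a0, a1, a2⟩ := hA x hx
  obtain ⟨b0, b1, b2⟩ := hB x hx
  have ht := hτ x hx
  have hA0 : 0 ≤ A := (abs_nonneg _).trans a0
  have hB0 : 0 ≤ B := (abs_nonneg _).trans b0
  have hAB := mul_nonneg hA0 hB0
  have p00 : |f x| * |g x| ≤ A * B := by gcongr
  refine ⟨by rw [abs_mul]; linarith, fun i => ?_, fun i j => ?_⟩
  · rw [pd_mul ((hf.contDiffAt (hU.mem_nhds hx)).differentiableAt (by norm_num))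
      ((hg.contDiffAt (hU.mem_nhds hx)).differentiableAt (by norm_num)) i]
    have p1 : (τ x * |pd i f x|) * |g x| ≤ A * B := by gcongr; exact a1 i
    have p2 : |f x| * (τ x * |pd i g x|) ≤ A * B := by gcongr; exact b1 i
    calc _ ≤ τ x * (|pd i f x| * |g x| + |f x| * |pd i g x|) := by
          rw [← abs_mul, ← abs_mul]; gcongr; exact abs_add_le _ _
      _ ≤ _ := by linarith
  · rw [pd_pd_mul hU hf hg i j hx]
    have p1 : (τ x ^ 2 * |pd i (pd j f) x|) * |g x| ≤ A * B := by gcongr; exact a2 i j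
    have p2 : (τ x * |pd j f x|) * (τ x * |pd i g x|) ≤ A * B := by
      gcongr
      · exact a1 j
      · exact b1 i
    have p3 : (τ x * |pd i f x|) * (τ x * |pd j g x|) ≤ A * B := by
      gcongr
      · exact a1 i
      · exact b1 j
    have p4 : |f x| * (τ x ^ 2 * |pd i (pd j g) x|) ≤ A * B := by gcongr; exact b2 i j
    calc _ ≤ τ x ^ 2 * ((|pd i (pd j f) x| * |g x| + |pd j f x| * |pd i g x|) +
          (|pd i f x| * |pd j g x| + |f x| * |pd i (pd j g) x|)) := by
          simp only [← abs_mul]; gcongr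
          refine (abs_add_le _ _).trans (add_le_add (abs_add_le _ _) (abs_add_le _ _))
      _ ≤ _ := by linarith

theorem scaledBound_zero (U : Set E3) (τ : E3 → ℝ) : ScaledBound U τ (fun _ => 0) := by
  have h : ∀ i, pd i (fun _ : E3 => (0 : ℝ)) = fun _ => 0 := fun i => by funext x; simp [pd]
  exact ⟨contDiffOn_const, 0, fun x _ => by simp [h]⟩

theorem ScaledBound.sum {U : Set E3} (hU : IsOpen U) {τ : E3 → ℝ} (hτ : ∀ x ∈ U, 0 ≤ τ x)
    {ι : Type*} (s : Finset ι) {f : ι → E3 → ℝ} (hf : ∀ a, ScaledBound U τ (f a)) :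
    ScaledBound U τ (fun x => ∑ a ∈ s, f a x) := by
  classical
  induction s using Finset.induction_on with
  | empty => simpa using scaledBound_zero U τ
  | insert a s ha ih => simpa [Finset.sum_insert ha] using ScaledBound.add hU hτ (hf a) ih

theorem ScaledBound.congr {U : Set E3} (hU : IsOpen U) {τ : E3 → ℝ} {f g : E3 → ℝ}
    (hf : ScaledBound U τ f) (h : Set.EqOn g f U) : ScaledBound U τ g := by
  obtain ⟨hf, A, hA⟩ := hf
  refine ⟨hf.congr h, A, fun x hx => ?_⟩
  have h1 := fun i => pd_congr_of_isOpen hU h i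
  have h2 := fun i j => pd_congr_of_isOpen hU (h1 j) i
  obtain ⟨a0, a1, a2⟩ := hA x hx
  exact ⟨by rwa [h hx], fun i => by rw [h1 i hx]; exact a1 i,
    fun i j => by rw [h2 i j hx]; exact a2 i j⟩

/-! ### The conformal Killing equation is of finite type -/

theorem abs_sum_fin_three_le {f : Fin 3 → ℝ} {B : ℝ} (h : ∀ i, |f i| ≤ B) :
    |∑ i, f i| ≤ 3 * B := by
  refine (Finset.abs_sum_le_sum_abs _ _).trans ?_
  calc _ ≤ ∑ _i : Fin 3, B := Finset.sum_le_sum fun i _ => h i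
    _ = 3 * B := by simp

/-- The symbol of the twice differentiated conformal Killing equation is injective, quantitatively.
Here `Z k i l m` plays the role of `∂ᵢ∂ₗ∂ₘ Xᵏ` and `p l m` that of `∂ₗ∂ₘ φ`. Lowering the index of
`Z` and permuting (as in the derivation of the Christoffel symbols) expresses `Z` in terms of `p`;
the symmetry of the result in its last two indices, contracted twice with the inverse `H` of `G`,
then determines `p`. The second contraction has the factor `4 = 2 (n - 1)`, `n = 3`. -/
theorem conformalKilling_symbol_bound {G H : Fin 3 → Fin 3 → ℝ} {Z : Fin 3 → Fin 3 → Fin 3 → Fin 3 → ℝ}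
    {p : Fin 3 → Fin 3 → ℝ} {r : Fin 3 → Fin 3 → Fin 3 → Fin 3 → ℝ} {A ε : ℝ}
    (hGs : ∀ i j, G i j = G j i)
    (hGH : ∀ i j, ∑ k, G i k * H k j = if i = j then 1 else 0)
    (hHG : ∀ i j, ∑ k, H i k * G k j = if i = j then 1 else 0)
    (hG : ∀ i j, |G i j| ≤ A) (hH : ∀ i j, |H i j| ≤ A)
    (hZ1 : ∀ k i l m, Z k i l m = Z k l i m) (hZ2 : ∀ k i l m, Z k i l m = Z k i m l)
    (hp : ∀ l m, p l m = p m l)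
    (hr : ∀ i j l m, |r i j l m| ≤ ε)
    (hE : ∀ i j l m, ∑ k, (G k j * Z k i l m + G i k * Z k j l m) = p l m * G i j + r i j l m)
    (k i l m : Fin 3) :
    |Z k i l m| ≤ (9 / 2) * A * ((54 * A + 122 * A ^ 3) * A + 1) * ε := by
  have hA : 0 ≤ A := (abs_nonneg _).trans (hG 0 0)
  have hε : 0 ≤ ε := (abs_nonneg _).trans (hr 0 0 0 0)
  let Y : Fin 3 → Fin 3 → Fin 3 → Fin 3 → ℝ := fun j i l m => ∑ k, G k j * Z k i l m
  let S : Fin 3 → Fin 3 → Fin 3 → Fin 3 → ℝ := fun i j l m => p l m * G i j + r i j l m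
  have hYS : ∀ i j l m, Y j i l m + Y i j l m = S i j l m := by
    intro i j l m
    have h := hE i j l m
    simp only [Y, S, ← h, Finset.sum_add_distrib, hGs i]
  have hY1 : ∀ j i l m, Y j i l m = Y j l i m := fun j i l m =>
    Finset.sum_congr rfl fun k _ => by rw [hZ1]
  have hY2 : ∀ j i l m, Y j i l m = Y j i m l := fun j i l m =>
    Finset.sum_congr rfl fun k _ => by rw [hZ2]
  have hYeq : ∀ j i l m, Y j i l m = (1 / 2) * (S i j l m + S l j i m - S i l j m) := by
    intro j i l m
    rw [← hYS, ← hYS, ← hYS, hY1 j l i m, hY1 l j i m, hY1 i l j m]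
    ring
  let D : Fin 3 → Fin 3 → Fin 3 → Fin 3 → ℝ :=
    fun i l j m => -(r i j l m + r l j i m - r i l j m) + (r i j m l + r m j i l - r i m j l)
  have hD : ∀ i l j m, |D i l j m| ≤ 6 * ε := by
    intro i l j m
    have h1 := abs_le.1 (hr i j l m)
    have h2 := abs_le.1 (hr l j i m)
    have h3 := abs_le.1 (hr i l j m)
    have h4 := abs_le.1 (hr i j m l)
    have h5 := abs_le.1 (hr m j i l)
    have h6 := abs_le.1 (hr i m j l)
    simp only [D]
    rw [abs_le]
    constructor <;> linarith [h1.1, h2.1, h3.1, h4.1, h5.1, h6.1, h1.2, h2.2, h3.2, h4.2, h5.2, h6.2]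
  -- the symmetry of `Y j i l m` in `l`, `m`
  have hcompat : ∀ i l j m, p i m * G l j - p j m * G i l - p i l * G m j + p j l * G i m =
      D i l j m := by
    intro i l j m
    have h := hY2 j i l m
    rw [hYeq, hYeq] at h
    simp only [S] at h
    simp only [D]
    rw [hp m l] at h
    linarith
  let q : Fin 3 → Fin 3 → ℝ := fun i m => ∑ l, ∑ j, H l j * D i l j m
  let P : ℝ := ∑ l, ∑ j, H l j * p j l
  have hq : ∀ i m, |q i m| ≤ 54 * A * ε := by
    intro i m
    refine (abs_sum_fin_three_le fun l => abs_sum_fin_three_le (B := A * (6 * ε)) fun j => ?_).trans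
      (by linarith)
    rw [abs_mul]
    exact mul_le_mul (hH _ _) (hD _ _ _ _) (abs_nonneg _) hA
  have htr : ∑ l, ∑ j, H l j * G l j = 3 := by
    have : ∀ l, ∑ j, H l j * G l j = 1 := fun l => by
      have h := hHG l l
      simp only [if_true] at h
      rw [← h]
      exact Finset.sum_congr rfl fun k _ => by rw [hGs l k]
    simp [this]
  have hc1 : ∀ i m, ∑ l, ∑ j, H l j * (p j m * G i l) = p i m := by
    intro i m
    rw [Finset.sum_comm]
    calc _ = ∑ j, p j m * ∑ l, G i l * H l j := by
          simp only [Finset.mul_sum]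
          exact Finset.sum_congr rfl fun _ _ => Finset.sum_congr rfl fun _ _ => by ring
      _ = _ := by simp [hGH]
  have hc2 : ∀ i m, ∑ l, ∑ j, H l j * (p i l * G m j) = p i m := by
    intro i m
    calc _ = ∑ l, p i l * ∑ j, H l j * G j m := by
          simp only [Finset.mul_sum]
          exact Finset.sum_congr rfl fun _ _ => Finset.sum_congr rfl fun j _ => by
            rw [hGs m j]; ring
      _ = _ := by simp [hHG]
  have hpq : ∀ i m, p i m + P * G i m = q i m := by
    intro i m
    have h : q i m = p i m * (∑ l, ∑ j, H l j * G l j) - ∑ l, ∑ j, H l j * (p j m * G i l)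
        - ∑ l, ∑ j, H l j * (p i l * G m j) + P * G i m := by
      simp only [q, P, ← hcompat, Finset.mul_sum, Finset.sum_mul, ← Finset.sum_sub_distrib,
        ← Finset.sum_add_distrib]
      exact Finset.sum_congr rfl fun _ _ => Finset.sum_congr rfl fun _ _ => by ring
    rw [h, htr, hc1, hc2]
    ring
  have hP4 : 4 * P = ∑ l, ∑ j, H l j * q j l := by
    have h : ∑ l, ∑ j, H l j * q j l = P + P * ∑ l, ∑ j, H l j * G l j := by
      simp only [← hpq, P, Finset.mul_sum, ← Finset.sum_add_distrib]
      refine Finset.sum_congr rfl fun l _ => Finset.sum_congr rfl fun j _ => ?_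
      rw [hGs j l]; ring
    rw [h, htr]; ring
  have hP : |P| ≤ 122 * A ^ 2 * ε := by
    have h : |4 * P| ≤ 3 * (3 * (A * (54 * A * ε))) := by
      rw [hP4]
      refine abs_sum_fin_three_le fun l => abs_sum_fin_three_le fun j => ?_
      rw [abs_mul]
      exact mul_le_mul (hH _ _) (hq _ _) (abs_nonneg _) hA
    rw [abs_mul, abs_of_pos (by norm_num : (0 : ℝ) < 4)] at h
    have : 0 ≤ A ^ 2 * ε := by positivity
    nlinarith
  have hpb : ∀ i m, |p i m| ≤ (54 * A + 122 * A ^ 3) * ε := by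
    intro i m
    have h : p i m = q i m - P * G i m := by rw [← hpq]; ring
    rw [h]
    calc _ ≤ |q i m| + |P * G i m| := abs_sub _ _
      _ ≤ 54 * A * ε + (122 * A ^ 2 * ε) * A := by
        rw [abs_mul]
        exact add_le_add (hq _ _) (mul_le_mul hP (hG _ _) (abs_nonneg _) (by positivity))
      _ = _ := by ring
  have hSb : ∀ i j l m, |S i j l m| ≤ ((54 * A + 122 * A ^ 3) * A + 1) * ε := by
    intro i j l m
    calc _ ≤ |p l m * G i j| + |r i j l m| := abs_add_le _ _
      _ ≤ ((54 * A + 122 * A ^ 3) * ε) * A + ε := by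
        rw [abs_mul]
        exact add_le_add (mul_le_mul (hpb _ _) (hG _ _) (abs_nonneg _) (by positivity)) (hr _ _ _ _)
      _ = _ := by ring
  have hYb : ∀ j i l m, |Y j i l m| ≤ (3 / 2) * (((54 * A + 122 * A ^ 3) * A + 1) * ε) := by
    intro j i l m
    have h1 := abs_le.1 (hSb i j l m)
    have h2 := abs_le.1 (hSb l j i m)
    have h3 := abs_le.1 (hSb i l j m)
    rw [hYeq, abs_le]
    constructor <;> linarith [h1.1, h2.1, h3.1, h1.2, h2.2, h3.2]
  have hZY : Z k i l m = ∑ j, H k j * Y j i l m := by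
    calc _ = ∑ k', (∑ j, H k j * G j k') * Z k' i l m := by simp [hHG]
      _ = _ := by
        simp only [Y, Finset.mul_sum, Finset.sum_mul]
        rw [Finset.sum_comm]
        exact Finset.sum_congr rfl fun j _ => Finset.sum_congr rfl fun k' _ => by
          rw [hGs j k']; ring
  rw [hZY]
  refine (abs_sum_fin_three_le
    (B := A * ((3 / 2) * (((54 * A + 122 * A ^ 3) * A + 1) * ε))) fun j => ?_).trans (le_of_eq ?_)
  · rw [abs_mul]
    exact mul_le_mul (hH _ _) (hYb _ _ _ _) (abs_nonneg _) hA
  · ring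

/-- The components of `X` and of its derivatives up to order two at `x` are bounded by `N`, with the
weights `τ²`, `τ`, `1`. -/
def JetBound (X : Fin 3 → E3 → ℝ) (τ N : ℝ) (x : E3) : Prop :=
  (∀ k, |X k x| ≤ N * τ ^ 2) ∧ (∀ k i, |pd i (X k) x| ≤ N * τ) ∧
    ∀ k i j, |pd i (pd j (X k)) x| ≤ N

theorem contDiffOn_lieMetric {U : Set E3} (hU : IsOpen U) {G : E3 → Matrix (Fin 3) (Fin 3) ℝ}
    {X : Fin 3 → E3 → ℝ} (hG : ∀ i j, ContDiffOn ℝ 3 (fun x => G x i j) U)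
    (hX : ∀ k, ContDiffOn ℝ 3 (X k) U) (i j : Fin 3) :
    ContDiffOn ℝ 2 (lieMetric G X i j) U := by
  have h23 : (2 : WithTop ℕ∞) ≤ 3 := by norm_num
  have hG2 := fun i j => (hG i j).of_le h23
  have hX2 := fun k => (hX k).of_le h23
  have hdX : ∀ i k, ContDiffOn ℝ 2 (pd i (X k)) U := fun i k => contDiffOn_pd (n := 2) hU (hX k) i
  have hdG : ∀ k i j, ContDiffOn ℝ 2 (pd k fun y => G y i j) U :=
    fun k i j => contDiffOn_pd (n := 2) hU (hG i j) k
  unfold lieMetric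
  exact ContDiffOn.sum fun k _ => (((hX2 k).mul (hdG k i j)).add ((hG2 k j).mul (hdX i k))).add
    ((hG2 i k).mul (hdX j k))

/-- The second derivatives of a product `f h`, when `f`, `∂f`, `∂²f` are of size `N τ²`, `N τ`, `N`
and `h` has scaled bounds. -/
theorem product_bounds_of_jet {U : Set E3} (hU : IsOpen U) {f h : E3 → ℝ}
    (hf : ContDiffOn ℝ 2 f U) (hh : ContDiffOn ℝ 2 h U) {x : E3} (hx : x ∈ U) {t A N : ℝ}
    (ht : 0 < t) (ht1 : t ≤ 1) (hf0 : |f x| ≤ N * t ^ 2) (hf1 : ∀ i, |pd i f x| ≤ N * t)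
    (hf2 : ∀ i j, |pd i (pd j f) x| ≤ N) (hh0 : |h x| ≤ A) (hh1 : ∀ i, t * |pd i h x| ≤ A)
    (hh2 : ∀ i j, t ^ 2 * |pd i (pd j h) x| ≤ A) :
    |f x * h x| ≤ A * N * t ∧ (∀ i, |pd i (fun y => f y * h y) x| ≤ 2 * (A * N)) ∧
      ∀ i j, |pd i (pd j fun y => f y * h y) x| ≤ 4 * (A * N) := by
  have hA : 0 ≤ A := (abs_nonneg _).trans hh0
  have hN : 0 ≤ N := (abs_nonneg _).trans (hf2 0 0)
  have hAN : 0 ≤ A * N := mul_nonneg hA hN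
  have hNt : N * t ≤ N := by nlinarith
  have hNt2 : N * t ^ 2 ≤ N * t := by nlinarith
  have d0 : ∀ {f : E3 → ℝ}, ContDiffOn ℝ 2 f U → DifferentiableAt ℝ f x :=
    fun h => (h.contDiffAt (hU.mem_nhds hx)).differentiableAt (by norm_num)
  refine ⟨?_, fun i => ?_, fun i j => ?_⟩
  · rw [abs_mul]
    calc _ ≤ (N * t) * A := by gcongr; exact hf0.trans hNt2
      _ = _ := by ring
  · rw [pd_mul (d0 hf) (d0 hh)]
    refine (abs_add_le _ _).trans ?_
    rw [abs_mul, abs_mul]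
    have h1 : |pd i f x| * |h x| ≤ N * A := by gcongr; exact (hf1 i).trans hNt
    have h2 : |f x| * |pd i h x| ≤ N * A := by
      calc _ ≤ (N * t ^ 2) * |pd i h x| := by gcongr
        _ = (N * t) * (t * |pd i h x|) := by ring
        _ ≤ N * A := by gcongr; exact hh1 i
    linarith
  · rw [pd_pd_mul hU hf hh i j hx]
    refine (abs_add_le _ _).trans ((add_le_add (abs_add_le _ _) (abs_add_le _ _)).trans ?_)
    simp only [abs_mul]
    have h1 : |pd i (pd j f) x| * |h x| ≤ N * A := by gcongr; exact hf2 i j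
    have h2 : ∀ a b, |pd a f x| * |pd b h x| ≤ N * A := fun a b => by
      calc _ ≤ (N * t) * |pd b h x| := by gcongr; exact hf1 a
        _ = N * (t * |pd b h x|) := by ring
        _ ≤ N * A := by gcongr; exact hh1 b
    have h3 : |f x| * |pd i (pd j h) x| ≤ N * A := by
      calc _ ≤ (N * t ^ 2) * |pd i (pd j h) x| := by gcongr
        _ = N * (t ^ 2 * |pd i (pd j h) x|) := by ring
        _ ≤ N * A := by gcongr; exact hh2 i j
    linarith [h2 i j, h2 j i]

/-- The second derivatives of a product `g w`, up to the term `g ∂²w`, when `g`, `∂g`, `τ ∂²g` are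
bounded and `w`, `∂w` are of size `N τ`, `N`. -/
theorem product_bounds_of_metric {U : Set E3} (hU : IsOpen U) {g w : E3 → ℝ}
    (hg : ContDiffOn ℝ 2 g U) (hw : ContDiffOn ℝ 2 w U) {x : E3} (hx : x ∈ U) {t A N : ℝ}
    (ht1 : t ≤ 1) (hg0 : |g x| ≤ A) (hg1 : ∀ i, |pd i g x| ≤ A)
    (hg2 : ∀ i j, t * |pd i (pd j g) x| ≤ A) (hw0 : |w x| ≤ N * t) (hw1 : ∀ i, |pd i w x| ≤ N) :
    |g x * w x| ≤ A * N * t ∧ (∀ i, |pd i (fun y => g y * w y) x| ≤ 2 * (A * N)) ∧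
      ∀ i j, |pd i (pd j fun y => g y * w y) x - g x * pd i (pd j w) x| ≤ 3 * (A * N) := by
  have hA : 0 ≤ A := (abs_nonneg _).trans hg0
  have hN : 0 ≤ N := (abs_nonneg _).trans (hw1 0)
  have hNt : N * t ≤ N := by nlinarith
  have d0 : ∀ {f : E3 → ℝ}, ContDiffOn ℝ 2 f U → DifferentiableAt ℝ f x :=
    fun h => (h.contDiffAt (hU.mem_nhds hx)).differentiableAt (by norm_num)
  refine ⟨?_, fun i => ?_, fun i j => ?_⟩
  · rw [abs_mul]
    calc _ ≤ A * (N * t) := by gcongr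
      _ = _ := by ring
  · rw [pd_mul (d0 hg) (d0 hw)]
    refine (abs_add_le _ _).trans ?_
    rw [abs_mul, abs_mul]
    have h1 : |pd i g x| * |w x| ≤ A * N := by
      gcongr
      · exact hg1 i
      · exact hw0.trans hNt
    have h2 : |g x| * |pd i w x| ≤ A * N := by gcongr; exact hw1 i
    linarith
  · rw [pd_pd_mul hU hg hw i j hx]
    have e : pd i (pd j g) x * w x + pd j g x * pd i w x
        + (pd i g x * pd j w x + g x * pd i (pd j w) x) - g x * pd i (pd j w) x
        = pd i (pd j g) x * w x + pd j g x * pd i w x + pd i g x * pd j w x := by ring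
    rw [e]
    refine (abs_add_le _ _).trans ((add_le_add (abs_add_le _ _) le_rfl).trans ?_)
    simp only [abs_mul]
    have h1 : |pd i (pd j g) x| * |w x| ≤ A * N := by
      calc _ ≤ |pd i (pd j g) x| * (N * t) := by gcongr
        _ = (t * |pd i (pd j g) x|) * N := by ring
        _ ≤ A * N := by gcongr; exact hg2 i j
    have h2 : ∀ a b, |pd a g x| * |pd b w x| ≤ A * N := fun a b => by
      gcongr
      · exact hg1 a
      · exact hw1 b
    linarith [h2 i j, h2 j i]

/-- Bounds for the Lie derivative of a metric with bounded first derivatives in the direction of a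
vector field with small two-jet. In the last one, the terms with third derivatives of the vector
field are left out. -/
theorem lieMetric_bounds {U : Set E3} (hU : IsOpen U) {G : E3 → Matrix (Fin 3) (Fin 3) ℝ}
    {X : Fin 3 → E3 → ℝ} (hG : ∀ i j, ContDiffOn ℝ 3 (fun x => G x i j) U)
    (hX : ∀ k, ContDiffOn ℝ 3 (X k) U) {x : E3} (hx : x ∈ U) {t A N : ℝ}
    (ht : 0 < t) (ht1 : t ≤ 1) (hG0 : ∀ i j, |G x i j| ≤ A)
    (hG1 : ∀ k i j, |pd k (fun y => G y i j) x| ≤ A)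
    (hG2 : ∀ l k i j, t * |pd l (pd k fun y => G y i j) x| ≤ A)
    (hG3 : ∀ m l k i j, t ^ 2 * |pd m (pd l (pd k fun y => G y i j)) x| ≤ A)
    (hJ : JetBound X t N x) (i j : Fin 3) :
    |lieMetric G X i j x| ≤ 9 * (A * N) * t ∧ (∀ l, |pd l (lieMetric G X i j) x| ≤ 18 * (A * N)) ∧
      ∀ l m, |pd l (pd m (lieMetric G X i j)) x - ∑ k, (G x k j * pd l (pd m (pd i (X k))) x
        + G x i k * pd l (pd m (pd j (X k))) x)| ≤ 30 * (A * N) := by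
  obtain ⟨hX0, hX1, hX2⟩ := hJ
  have h23 : (2 : WithTop ℕ∞) ≤ 3 := by norm_num
  have cG := fun i j => (hG i j).of_le h23
  have cX := fun k => (hX k).of_le h23
  have cdX : ∀ i k, ContDiffOn ℝ 2 (pd i (X k)) U := fun i k => contDiffOn_pd (n := 2) hU (hX k) i
  have cdG : ∀ k i j, ContDiffOn ℝ 2 (pd k fun y => G y i j) U :=
    fun k i j => contDiffOn_pd (n := 2) hU (hG i j) k
  have d0 : ∀ {f : E3 → ℝ}, ContDiffOn ℝ 2 f U → DifferentiableAt ℝ f x :=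
    fun h => (h.contDiffAt (hU.mem_nhds hx)).differentiableAt (by norm_num)
  have B1 := fun k => product_bounds_of_jet hU (cX k) (cdG k i j) hx ht ht1 (hX0 k) (hX1 k) (hX2 k)
    (hG1 k i j) (fun l => hG2 l k i j) fun m l => hG3 m l k i j
  have B2 := fun a b k c => product_bounds_of_metric hU (cG a b) (cdX c k) hx ht1 (hG0 a b)
    (fun l => hG1 l a b) (fun m l => hG2 m l a b) (hX1 k c) fun l => hX2 k l c
  have c12 := fun k => (((cX k).mul (cdG k i j)).add ((cG k j).mul (cdX i k)))
  have c3 := fun k => (cG i k).mul (cdX j k)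
  refine ⟨?_, fun l => ?_, fun l m => ?_⟩
  · refine (abs_sum_fin_three_le (B := 3 * (A * N * t)) fun k => ?_).trans (by linarith)
    refine (abs_add_le _ _).trans ((add_le_add (abs_add_le _ _) le_rfl).trans ?_)
    linarith [(B1 k).1, (B2 k j k i).1, (B2 i k k j).1]
  · have e : pd l (lieMetric G X i j) x = ∑ k, (pd l (fun y => X k y * pd k (fun y => G y i j) y) x
        + pd l (fun y => G y k j * pd i (X k) y) x + pd l (fun y => G y i k * pd j (X k) y) x) := by
      unfold lieMetric
      rw [pd_sum fun k _ => d0 ((c12 k).add (c3 k))]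
      refine Finset.sum_congr rfl fun k _ => ?_
      rw [pd_add (d0 (c12 k)) (d0 (c3 k)),
        pd_add (d0 ((cX k).mul (cdG k i j))) (d0 ((cG k j).mul (cdX i k)))]
    rw [e]
    refine (abs_sum_fin_three_le (B := 6 * (A * N)) fun k => ?_).trans (by linarith)
    refine (abs_add_le _ _).trans ((add_le_add (abs_add_le _ _) le_rfl).trans ?_)
    linarith [(B1 k).2.1 l, (B2 k j k i).2.1 l, (B2 i k k j).2.1 l]
  · have e : pd l (pd m (lieMetric G X i j)) x =
        ∑ k, (pd l (pd m fun y => X k y * pd k (fun y => G y i j) y) x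
        + pd l (pd m fun y => G y k j * pd i (X k) y) x
        + pd l (pd m fun y => G y i k * pd j (X k) y) x) := by
      unfold lieMetric
      rw [pd_pd_sum hU (fun k _ => (c12 k).add (c3 k)) l m hx]
      refine Finset.sum_congr rfl fun k _ => ?_
      rw [pd_pd_add hU (c12 k) (c3 k) l m hx,
        pd_pd_add hU ((cX k).mul (cdG k i j)) ((cG k j).mul (cdX i k)) l m hx]
    rw [e, ← Finset.sum_sub_distrib]
    refine (abs_sum_fin_three_le (B := 10 * (A * N)) fun k => ?_).trans (by linarith)
    have e3 : ∀ a b c d e : ℝ, a + b + c - (d + e) = a + (b - d) + (c - e) := by intros; ring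
    rw [e3]
    refine (abs_add_le _ _).trans ((add_le_add (abs_add_le _ _) le_rfl).trans ?_)
    linarith [(B1 k).2.2 l m, (B2 k j k i).2.2 l m, (B2 i k k j).2.2 l m]

/-- A conformal Killing field of a metric `G` with `G`, `G⁻¹`, `∂G`, `τ ∂²G`, `τ² ∂³G` bounded
satisfies `|∂³X| ≤ C (|∂²X| + τ⁻¹ |∂X| + τ⁻² |X|)`. -/
theorem exists_third_derivative_bound {U : Set E3} (hU : IsOpen U) {τ : E3 → ℝ}
    (hτ : ∀ x ∈ U, 0 < τ x ∧ τ x ≤ 1) {G : E3 → Matrix (Fin 3) (Fin 3) ℝ} {X : Fin 3 → E3 → ℝ}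
    {A : ℝ} (hG : ∀ i j, ContDiffOn ℝ 3 (fun x => G x i j) U)
    (hGs : ∀ x ∈ U, ∀ i j, G x i j = G x j i) (hGb : ∀ x ∈ U, ∀ i j, |G x i j| ≤ A)
    (hdet : ∀ x ∈ U, IsUnit (G x).det) (hGi : ∀ x ∈ U, ∀ i j, |(G x)⁻¹ i j| ≤ A)
    (h00 : ∀ x ∈ U, G x 0 0 ≠ 0 ∧ |(G x 0 0)⁻¹| ≤ A)
    (hdG : ∀ k i j, ScaledBound U τ (pd k fun y => G y i j))
    (hX : ∀ k, ContDiffOn ℝ 3 (X k) U)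
    (hL : ∀ x ∈ U, ∃ c : ℝ, ∀ i j, lieMetric G X i j x = c * G x i j) :
    ∃ C, ∀ x ∈ U, ∀ N, JetBound X (τ x) N x →
      ∀ k i l m, |pd i (pd l (pd m (X k))) x| ≤ C * N := by
  choose B hB using fun k i j => (hdG k i j).2
  obtain ⟨A', hA1, hAA, hBA⟩ : ∃ A' : ℝ, 1 ≤ A' ∧ A ≤ A' ∧ ∀ k i j, B k i j ≤ A' := by
    obtain ⟨A₁, hA₁⟩ :=
      (Set.finite_range fun a : Fin 3 × Fin 3 × Fin 3 => B a.1 a.2.1 a.2.2).bddAbove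
    exact ⟨max 1 (max A A₁), le_max_left _ _, (le_max_left _ _).trans (le_max_right _ _),
      fun k i j => (hA₁ (Set.mem_range_self (k, i, j))).trans
        ((le_max_right _ _).trans (le_max_right _ _))⟩
  have h23 : (2 : WithTop ℕ∞) ≤ 3 := by norm_num
  have cG := fun i j => (hG i j).of_le h23
  have cL := contDiffOn_lieMetric hU hG hX
  -- the conformal factor, with its regularity
  let φ : E3 → ℝ := fun x => lieMetric G X 0 0 x * (G x 0 0)⁻¹
  have cφ : ContDiffOn ℝ 2 φ U := (cL 0 0).mul ((cG 0 0).inv fun x hx => (h00 x hx).1)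
  have hLφ : ∀ i j, Set.EqOn (lieMetric G X i j) (fun x => φ x * G x i j) U := by
    intro i j x hx
    obtain ⟨c, hc⟩ := hL x hx
    have h := (h00 x hx).1
    simp only [φ, hc]
    field_simp
  refine ⟨(9 / 2) * A' * ((54 * A' + 122 * A' ^ 3) * A' + 1) * (111 * A' ^ 5), fun x hx N hJ => ?_⟩
  obtain ⟨ht, ht1⟩ := hτ x hx
  set t := τ x
  have hN : 0 ≤ N := (abs_nonneg _).trans (hJ.2.2 0 0 0)
  have hG0 : ∀ i j, |G x i j| ≤ A' := fun i j => (hGb x hx i j).trans hAA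
  have hG1 : ∀ k i j, |pd k (fun y => G y i j) x| ≤ A' := fun k i j =>
    (hB k i j x hx).1.trans (hBA k i j)
  have hG2 : ∀ l k i j, t * |pd l (pd k fun y => G y i j) x| ≤ A' := fun l k i j =>
    ((hB k i j x hx).2.1 l).trans (hBA k i j)
  have hG3 : ∀ m l k i j, t ^ 2 * |pd m (pd l (pd k fun y => G y i j)) x| ≤ A' := fun m l k i j =>
    ((hB k i j x hx).2.2 m l).trans (hBA k i j)
  have hLb := lieMetric_bounds hU hG hX hx ht ht1 hG0 hG1 hG2 hG3 hJ
  have hA0 : 0 ≤ A' := by linarith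
  have hφ0 : |φ x| ≤ (27 * A' ^ 4 * N) * t := by
    simp only [φ, abs_mul]
    calc _ ≤ (9 * (A' * N) * t) * A' := by
          gcongr
          · exact (hLb 0 0).1
          · exact (h00 x hx).2.trans hAA
      _ = 9 * A' ^ 2 * (N * t) := by ring
      _ ≤ 27 * A' ^ 4 * (N * t) := by
          gcongr <;> norm_num
      _ = _ := by ring
  have hφ0' : |φ x| ≤ 9 * A' ^ 2 * N := by
    simp only [φ, abs_mul]
    calc _ ≤ (9 * (A' * N) * t) * A' := by
          gcongr
          · exact (hLb 0 0).1
          · exact (h00 x hx).2.trans hAA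
      _ ≤ (9 * (A' * N) * 1) * A' := by gcongr
      _ = _ := by ring
  have d0 : ∀ {f : E3 → ℝ}, ContDiffOn ℝ 2 f U → DifferentiableAt ℝ f x :=
    fun h => (h.contDiffAt (hU.mem_nhds hx)).differentiableAt (by norm_num)
  have hφ1 : ∀ l, |pd l φ x| ≤ 27 * A' ^ 4 * N := by
    intro l
    have e := pd_congr_of_isOpen hU (hLφ 0 0) l hx
    rw [pd_mul (d0 cφ) (d0 (cG 0 0))] at e
    have e2 : pd l φ x = (pd l (lieMetric G X 0 0) x - φ x * pd l (fun y => G y 0 0) x)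
        * (G x 0 0)⁻¹ := by
      rw [e]
      have h := (h00 x hx).1
      field_simp
      ring
    rw [e2, abs_mul]
    calc _ ≤ (18 * (A' * N) + (9 * A' ^ 2 * N) * A') * A' := by
          gcongr
          · refine (abs_sub _ _).trans (add_le_add ((hLb 0 0).2.1 l) ?_)
            rw [abs_mul]
            gcongr
            exact hG1 l 0 0
          · exact (h00 x hx).2.trans hAA
      _ = (18 * A' ^ 2 + 9 * A' ^ 4) * N := by ring
      _ ≤ (18 * A' ^ 4 + 9 * A' ^ 4) * N := by
          gcongr
          norm_num
      _ = _ := by ring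
  have hφG := fun i j => product_bounds_of_metric hU (cG i j) cφ hx ht1 (hG0 i j)
    (fun l => hG1 l i j) (fun m l => hG2 m l i j) hφ0 hφ1
  have cX3 : ∀ k, ContDiffAt ℝ 3 (X k) x := fun k => (hX k).contDiffAt (hU.mem_nhds hx)
  have c2 : ∀ m k, ContDiffAt ℝ 2 (pd m (X k)) x := fun m k =>
    (contDiffOn_pd (n := 2) hU (hX k) m).contDiffAt (hU.mem_nhds hx)
  have hs1 : ∀ k i l m, pd i (pd l (pd m (X k))) x = pd l (pd i (pd m (X k))) x :=
    fun k i l m => pd_comm (c2 m k) i l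
  have hs2 : ∀ k i l m, pd i (pd l (pd m (X k))) x = pd i (pd m (pd l (X k))) x :=
    fun k i l m => pd_congr_of_isOpen hU
      (fun y hy => pd_comm (((hX k).contDiffAt (hU.mem_nhds hy)).of_le h23) l m) i hx
  have key := conformalKilling_symbol_bound (G := G x) 
    (H := ((G x)⁻¹ : Matrix (Fin 3) (Fin 3) ℝ))
    (Z := fun k i l m => pd i (pd l (pd m (X k))) x) (p := fun l m => pd l (pd m φ) x)
    (r := fun i j l m => ∑ k, (G x k j * pd i (pd l (pd m (X k))) x
        + G x i k * pd j (pd l (pd m (X k))) x) - pd l (pd m φ) x * G x i j) (A := A')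
    (ε := 111 * A' ^ 5 * N) (hGs x hx)
    (fun i j => by
      have := congrFun₂ (Matrix.mul_nonsing_inv _ (hdet x hx)) i j
      rwa [Matrix.mul_apply, Matrix.one_apply] at this)
    (fun i j => by
      have := congrFun₂ (Matrix.nonsing_inv_mul _ (hdet x hx)) i j
      rwa [Matrix.mul_apply, Matrix.one_apply] at this)
    hG0 (fun i j => (hGi x hx i j).trans hAA) hs1 hs2
    (fun l m => pd_comm (cφ.contDiffAt (hU.mem_nhds hx)) l m) ?_ (fun i j l m => by ring)
  · intro k i l m
    exact (key k i l m).trans (le_of_eq (by ring))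
  · intro i j l m
    have e1 := pd_congr_of_isOpen hU (fun y hy => pd_congr_of_isOpen hU (hLφ i j) m hy) l hx
    have e2 : (fun y => φ y * G y i j) = fun y => G y i j * φ y := by funext y; ring
    rw [e2] at e1
    have h1 := (hLb i j).2.2 l m
    have h2 := (hφG i j).2.2 l m
    have e3 : ∀ a b, pd a (pd l (pd m (X b))) x = pd l (pd m (pd a (X b))) x := fun a b => by
      rw [hs1, hs2]
    have e4 : ∑ k, (G x k j * pd i (pd l (pd m (X k))) x + G x i k * pd j (pd l (pd m (X k))) x)
        - pd l (pd m φ) x * G x i j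
        = (pd l (pd m fun y => G y i j * φ y) x - G x i j * pd l (pd m φ) x)
          - (pd l (pd m (lieMetric G X i j)) x - ∑ k, (G x k j * pd l (pd m (pd i (X k))) x
            + G x i k * pd l (pd m (pd j (X k))) x)) := by
      rw [e1]
      simp only [e3]
      ring
    rw [e4]
    refine (abs_sub _ _).trans ((add_le_add h2 h1).trans ?_)
    have : A' * N ≤ A' ^ 5 * N := by
      gcongr
      exact le_self_pow₀ hA1 (by norm_num)
    nlinarith

/-! ### Unique continuation along rays -/

theorem fderiv_apply_eq_sum_pd (f : E3 → ℝ) (x v : E3) :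
    fderiv ℝ f x v = ∑ i, v i * pd i f x := by
  have h : v = ∑ i, v i • (EuclideanSpace.single i (1 : ℝ) : E3) := by
    ext j
    simp [Finset.sum_apply, Pi.single_apply]
  conv_lhs => rw [h]
  simp [pd]

theorem hasDerivAt_comp_ray {f : E3 → ℝ} {q v : E3} {t : ℝ}
    (hf : DifferentiableAt ℝ f (q + t • v)) :
    HasDerivAt (fun t : ℝ => f (q + t • v)) (∑ i, v i * pd i f (q + t • v)) t := by
  rw [← fderiv_apply_eq_sum_pd]
  have h : HasDerivAt (fun t : ℝ => q + t • v) v t := by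
    simpa using ((hasDerivAt_id t).smul_const v).const_add q
  exact hf.hasFDerivAt.comp_hasDerivAt t h

/-- If `f` tends to zero at `0` and `|f'| ≤ A t ^ a` with `a ≥ 0`, then `|f| ≤ A t ^ (a + 1)`. -/
theorem abs_le_rpow_of_deriv_le_rpow {f f' : ℝ → ℝ} {T A a b N : ℝ} (ha : 0 ≤ a) (hb : 0 < b)
    (hA : 0 ≤ A) (hf : ∀ t ∈ Set.Ioo 0 T, HasDerivAt f (f' t) t)
    (hf' : ∀ t ∈ Set.Ioo 0 T, |f' t| ≤ A * t ^ a) (hN : ∀ t ∈ Set.Ioo 0 T, |f t| ≤ N * t ^ b) :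
    ∀ t ∈ Set.Ioo 0 T, |f t| ≤ A * t ^ (a + 1) := by
  intro t ht
  have key : ∀ ε ∈ Set.Ioo 0 t, |f t| ≤ A * t ^ (a + 1) + N * ε ^ b := by
    intro ε hε
    have hsub : Set.Icc ε t ⊆ Set.Ioo 0 T := fun u hu =>
      ⟨hε.1.trans_le hu.1, hu.2.trans_lt ht.2⟩
    have h := Convex.norm_image_sub_le_of_norm_hasDerivWithin_le (f := f) (f' := f')
      (s := Set.Icc ε t) (x := ε) (y := t) (C := A * t ^ a)
      (fun u hu => (hf u (hsub hu)).hasDerivWithinAt)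
      (fun u hu => (hf' u (hsub hu)).trans (mul_le_mul_of_nonneg_left
        (Real.rpow_le_rpow (hε.1.le.trans hu.1) hu.2 ha) hA))
      (convex_Icc _ _) ⟨le_rfl, hε.2.le⟩ ⟨hε.2.le, le_rfl⟩
    rw [Real.norm_eq_abs, Real.norm_eq_abs, abs_of_pos (by linarith [hε.2] : 0 < t - ε)] at h
    have h1 : A * t ^ a * (t - ε) ≤ A * t ^ (a + 1) := by
      rw [Real.rpow_add_one ht.1.ne', ← mul_assoc]
      exact mul_le_mul_of_nonneg_left (by linarith [hε.1])
        (mul_nonneg hA (Real.rpow_nonneg ht.1.le _))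
    have h2 := hN ε (hsub ⟨le_rfl, hε.2.le⟩)
    have h3 : |f t| ≤ |f t - f ε| + |f ε| := by simpa using abs_add_le (f t - f ε) (f ε)
    linarith
  have hlim : Filter.Tendsto (fun ε : ℝ => A * t ^ (a + 1) + N * ε ^ b) (𝓝[>] 0)
      (𝓝 (A * t ^ (a + 1))) := by
    have h := ((Real.continuousAt_rpow_const 0 b (Or.inr hb.le)).tendsto.const_mul N).const_add
      (A * t ^ (a + 1))
    rw [Real.zero_rpow hb.ne', mul_zero, add_zero] at h
    exact h.mono_left nhdsWithin_le_nhds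
  exact ge_of_tendsto hlim (Filter.mem_of_superset (Ioo_mem_nhdsGT ht.1) key)

/-- Unique continuation for the differential inequality
`|∂³X| ≤ C (|∂²X| + τ⁻¹ |∂X| + τ⁻² |X|)` along a ray issuing from a point where `τ` may vanish, for
fields whose two-jet vanishes there to positive order. Integrating the inequality three times
improves the constant in the assumed decay by a factor of one half if the ray is short; the order of
vanishing does not matter. -/
theorem eq_zero_along_ray {U : Set E3} (hU : IsOpen U) {τ : E3 → ℝ} {X : Fin 3 → E3 → ℝ}
    (hX : ∀ k, ContDiffOn ℝ 3 (X k) U) {C : ℝ} (hC0 : 0 ≤ C)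
    (hC : ∀ x ∈ U, ∀ N, JetBound X (τ x) N x →
      ∀ k i l m, |pd i (pd l (pd m (X k))) x| ≤ C * N)
    {q v : E3} (hv : ∀ i, |v i| ≤ 1) {T s N : ℝ} (hs : 0 < s)
    (hCT : 54 * C * T ≤ 1)
    (hγ : ∀ t ∈ Set.Ioo 0 T, q + t • v ∈ U ∧ t ≤ τ (q + t • v))
    (h0 : ∀ t ∈ Set.Ioo 0 T, (∀ k, |X k (q + t • v)| ≤ N * t ^ (s + 2)) ∧
      (∀ k i, |pd i (X k) (q + t • v)| ≤ N * t ^ (s + 1)) ∧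
      ∀ k i j, |pd i (pd j (X k)) (q + t • v)| ≤ N * t ^ s) :
    ∀ t ∈ Set.Ioo 0 T, ∀ k, X k (q + t • v) = 0 := by
  let P : ℝ → Prop := fun N => ∀ t ∈ Set.Ioo 0 T, (∀ k, |X k (q + t • v)| ≤ N * t ^ (s + 2)) ∧
      (∀ k i, |pd i (X k) (q + t • v)| ≤ N * t ^ (s + 1)) ∧
      ∀ k i j, |pd i (pd j (X k)) (q + t • v)| ≤ N * t ^ s
  have c2 : ∀ k i, ContDiffOn ℝ 2 (pd i (X k)) U := fun k i => contDiffOn_pd (n := 2) hU (hX k) i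
  have c1 : ∀ k i j, ContDiffOn ℝ 1 (pd j (pd i (X k))) U := fun k i j =>
    contDiffOn_pd (n := 1) hU (c2 k i) j
  have hdir : ∀ {f : E3 → ℝ} {x : E3} {B : ℝ}, (∀ i, |pd i f x| ≤ B) →
      |∑ i, v i * pd i f x| ≤ 3 * B := fun {f x B} h => abs_sum_fin_three_le fun i => by
    rw [abs_mul]
    calc _ ≤ 1 * |pd i f x| := mul_le_mul_of_nonneg_right (hv i) (abs_nonneg _)
      _ ≤ B := by rw [one_mul]; exact h i
  have step : ∀ N, P N → P (N / 2) := by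
    intro N hN
    by_cases hT : T ≤ 0
    · intro t ht; exact absurd (ht.1.trans ht.2) (not_lt.2 hT)
    push Not at hT
    have hN0 : 0 ≤ N := by
      have hm : T / 2 ∈ Set.Ioo 0 T := ⟨by linarith, by linarith⟩
      have h := (abs_nonneg _).trans ((hN _ hm).2.2 0 0 0)
      exact nonneg_of_mul_nonneg_left h (Real.rpow_pos_of_pos hm.1 _)
    have hCN : 0 ≤ C * N := mul_nonneg hC0 hN0
    -- the bound on third derivatives
    have h3 : ∀ t ∈ Set.Ioo 0 T, ∀ k i l m,
        |pd i (pd l (pd m (X k))) (q + t • v)| ≤ C * N * t ^ s := by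
      intro t ht k i l m
      obtain ⟨a0, a1, a2⟩ := hN t ht
      obtain ⟨hU', hτ⟩ := hγ t ht
      have hts : 0 ≤ N * t ^ s := mul_nonneg hN0 (Real.rpow_nonneg ht.1.le _)
      rw [mul_assoc]
      refine hC _ hU' _ ⟨fun k => (a0 k).trans ?_, fun k i => (a1 k i).trans ?_, a2⟩ k i l m
      · rw [Real.rpow_add ht.1, ← mul_assoc, Real.rpow_two]
        gcongr
        exact ht.1.le
      · rw [Real.rpow_add_one ht.1.ne', ← mul_assoc]
        gcongr
    have d2 : ∀ t ∈ Set.Ioo 0 T, ∀ k i j,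
        |pd i (pd j (X k)) (q + t • v)| ≤ (3 * (C * N)) * t ^ (s + 1) := fun t ht k i j =>
      abs_le_rpow_of_deriv_le_rpow (f := fun t => pd i (pd j (X k)) (q + t • v)) hs.le hs
        (by positivity) (fun u hu => hasDerivAt_comp_ray (((c1 k j i).contDiffAt
          (hU.mem_nhds (hγ u hu).1)).differentiableAt (by norm_num)))
        (fun u hu => (hdir fun l => h3 u hu k l i j).trans (le_of_eq (by ring)))
        (fun u hu => (hN u hu).2.2 k i j) t ht
    have d1 : ∀ t ∈ Set.Ioo 0 T, ∀ k i,
        |pd i (X k) (q + t • v)| ≤ (9 * (C * N)) * t ^ (s + 1 + 1) := fun t ht k i =>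
      abs_le_rpow_of_deriv_le_rpow (f := fun t => pd i (X k) (q + t • v)) (by positivity)
        (by positivity : 0 < s + 1)
        (by positivity) (fun u hu => hasDerivAt_comp_ray (((c2 k i).contDiffAt
          (hU.mem_nhds (hγ u hu).1)).differentiableAt (by norm_num)))
        (fun u hu => (hdir fun l => d2 u hu k l i).trans (le_of_eq (by ring)))
        (fun u hu => (hN u hu).2.1 k i) t ht
    have d0 : ∀ t ∈ Set.Ioo 0 T, ∀ k,
        |X k (q + t • v)| ≤ (27 * (C * N)) * t ^ (s + 1 + 1 + 1) := fun t ht k =>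
      abs_le_rpow_of_deriv_le_rpow (f := fun t => X k (q + t • v)) (by positivity)
        (by positivity : 0 < s + 2)
        (by positivity) (fun u hu => hasDerivAt_comp_ray (((hX k).contDiffAt
          (hU.mem_nhds (hγ u hu).1)).differentiableAt (by norm_num)))
        (fun u hu => (hdir fun l => d1 u hu k l).trans (le_of_eq (by ring)))
        (fun u hu => (hN u hu).1 k) t ht
    have fin : ∀ t ∈ Set.Ioo 0 T, ∀ c a : ℝ, 0 ≤ c → c ≤ 27 →
        (c * (C * N)) * t ^ (a + 1) ≤ N / 2 * t ^ a := by
      intro t ht c a hc hc27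
      rw [Real.rpow_add_one ht.1.ne']
      have hta : 0 ≤ t ^ a := Real.rpow_nonneg ht.1.le _
      have h1 : c * (C * N) * t ≤ 27 * (C * N) * T := by
        gcongr
        exacts [ht.1.le, ht.2.le]
      have h2 : 27 * (C * N) * T ≤ N / 2 := by nlinarith
      calc _ = (c * (C * N) * t) * t ^ a := by ring
        _ ≤ _ := by gcongr; exact h1.trans h2
    intro t ht
    refine ⟨fun k => (d0 t ht k).trans ?_, fun k i => (d1 t ht k i).trans ?_,
      fun k i j => (d2 t ht k i j).trans ?_⟩
    · have : s + 1 + 1 + 1 = (s + 2) + 1 := by ring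
      rw [this]
      exact fin t ht 27 _ (by norm_num) le_rfl
    · exact fin t ht 9 _ (by norm_num) (by norm_num)
    · exact fin t ht 3 _ (by norm_num) (by norm_num)
  have hP : ∀ n : ℕ, P (N * (1 / 2) ^ n) := by
    intro n
    induction n with
    | zero => rw [pow_zero, mul_one]; exact h0
    | succ n ih =>
      have h := step _ ih
      rwa [show N * (1 / 2) ^ n / 2 = N * (1 / 2) ^ (n + 1) by ring] at h
  intro t ht k
  have hlim : Filter.Tendsto (fun n : ℕ => N * (1 / 2 : ℝ) ^ n * t ^ (s + 2)) Filter.atTop (𝓝 0) := by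
    have h := ((tendsto_pow_atTop_nhds_zero_of_lt_one (r := (1 / 2 : ℝ)) (by norm_num)
      (by norm_num)).const_mul N).mul_const (t ^ (s + 2))
    simpa using h
  exact abs_nonpos_iff.1 (ge_of_tendsto' hlim fun n => (hP n t ht).1 k)

/-! ### Charts of a manifold with boundary -/

section Charts

variable {Mbar : Type*} [TopologicalSpace Mbar]

theorem isOpen_chartInterior (e : OpenPartialHomeomorph Mbar H3) : IsOpen (chartInterior e) := by
  have h : chartInterior e = (𝓡∂ 3).symm ⁻¹' e.target ∩ {x : E3 | 0 < x 0} := by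
    ext x
    simp only [chartInterior, e.extend_target, range_modelWithCornersEuclideanHalfSpace,
      Set.mem_inter_iff, Set.mem_ofPred_eq, Set.mem_preimage]
    exact ⟨fun h => ⟨h.1.1, h.2⟩, fun h => ⟨⟨h.1, h.2.le⟩, h.2⟩⟩
  rw [h]
  exact (e.open_target.preimage (𝓡∂ 3).continuous_symm).inter
    (isOpen_lt continuous_const (by fun_prop))

theorem chartInterior_subset_target (e : OpenPartialHomeomorph Mbar H3) :
    chartInterior e ⊆ (e.extend (𝓡∂ 3)).target := fun _ h => h.1

theorem chartPoint_mem_source {e : OpenPartialHomeomorph Mbar H3} {x : E3}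
    (hx : x ∈ (e.extend (𝓡∂ 3)).target) : chartPoint e x ∈ e.source := by
  have h := (e.extend (𝓡∂ 3)).map_target hx
  rwa [e.extend_source] at h

theorem extend_chartPoint {e : OpenPartialHomeomorph Mbar H3} {x : E3}
    (hx : x ∈ (e.extend (𝓡∂ 3)).target) : e.extend (𝓡∂ 3) (chartPoint e x) = x :=
  (e.extend (𝓡∂ 3)).right_inv hx

theorem nonneg_of_mem_target {e : OpenPartialHomeomorph Mbar H3} {x : E3}
    (hx : x ∈ (e.extend (𝓡∂ 3)).target) : 0 ≤ x 0 := by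
  have h := e.extend_target_subset_range hx
  rwa [range_modelWithCornersEuclideanHalfSpace] at h

variable [ChartedSpace H3 Mbar] [IsManifold (𝓡∂ 3) ∞ Mbar]

theorem chartPoint_mem_interior_iff {p : Mbar} {x : E3}
    (hx : x ∈ ((chartAt H3 p).extend (𝓡∂ 3)).target) :
    chartPoint (chartAt H3 p) x ∈ (𝓡∂ 3).interior Mbar ↔ 0 < x 0 := by
  have h := (𝓡∂ 3).isInteriorPoint_iff_of_mem_atlas (n := ∞) (by simp)
    (chart_mem_atlas H3 p) (chartPoint_mem_source hx)
  rw [extend_chartPoint hx] at h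
  refine h.trans ⟨fun h' => ?_, fun h' => ?_⟩
  · have h2 := OpenPartialHomeomorph.interior_extend_target_subset_interior_range _ h'
    rwa [interior_range_modelWithCornersEuclideanHalfSpace] at h2
  · exact interior_maximal (chartInterior_subset_target _) (isOpen_chartInterior _) ⟨hx, h'⟩

theorem chartPoint_mem_boundary_iff {p : Mbar} {x : E3}
    (hx : x ∈ ((chartAt H3 p).extend (𝓡∂ 3)).target) :
    chartPoint (chartAt H3 p) x ∈ (𝓡∂ 3).boundary Mbar ↔ x 0 = 0 := by
  rw [← ModelWithCorners.compl_interior, Set.mem_compl_iff, chartPoint_mem_interior_iff hx]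
  have := nonneg_of_mem_target hx
  exact ⟨fun h => le_antisymm (not_lt.1 h) this, fun h => by rw [h]; exact lt_irrefl 0⟩

theorem coordVec_eq_symmL {p : Mbar} {x : E3}
    (hx : x ∈ ((chartAt H3 p).extend (𝓡∂ 3)).target) (i : Fin 3) :
    coordVec (chartAt H3 p) x i =
      (trivializationAt E3 (TangentSpace (𝓡∂ 3)) p).symmL ℝ (chartPoint (chartAt H3 p) x)
        (EuclideanSpace.single i (1 : ℝ)) := by
  have hs := chartPoint_mem_source hx
  rw [TangentBundle.symmL_trivializationAt hs]
  change _ = mfderivWithin _ _ _ _ ((chartAt H3 p).extend (𝓡∂ 3) (chartPoint (chartAt H3 p) x)) _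
  rw [extend_chartPoint hx]
  rfl

/-- The coordinate vector fields of a chart are smooth on its domain. -/
theorem contMDiffOn_coordFrame (p : Mbar) (i : Fin 3) :
    ContMDiffOn (𝓡∂ 3) ((𝓡∂ 3).prod 𝓘(ℝ, E3)) ∞
      (fun q => Bundle.TotalSpace.mk' E3 q ((trivializationAt E3 (TangentSpace (𝓡∂ 3)) p).symmL ℝ q
        (EuclideanSpace.single i (1 : ℝ)) : TangentSpace (𝓡∂ 3) q)) (chartAt H3 p).source := by
  have h := (trivializationAt E3 (TangentSpace (𝓡∂ 3)) p).contMDiffOn_localFrame_baseSet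
    (I := 𝓡∂ 3) ∞ (EuclideanSpace.basisFun (Fin 3) ℝ).toBasis i
  rw [TangentBundle.trivializationAt_baseSet] at h
  refine h.congr fun q hq => ?_
  congr 1
  rw [Bundle.Trivialization.localFrame_apply_of_mem_baseSet _ _
    (by rwa [TangentBundle.trivializationAt_baseSet])]
  rw [Bundle.Trivialization.symmL_apply _ (by rwa [TangentBundle.trivializationAt_baseSet])]
  simp [Bundle.Trivialization.basisAt]

theorem contDiffOn_bilinComp (b : SmoothMetric Mbar) (p : Mbar) (i j : Fin 3) :
    ContDiffOn ℝ ∞ (fun x => bilinComp b.inner (chartAt H3 p) x i j)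
      ((chartAt H3 p).extend (𝓡∂ 3)).target := by
  have h1 : ContMDiffOn (𝓡∂ 3) ((𝓡∂ 3).prod 𝓘(ℝ)) ∞
      (fun q => Bundle.TotalSpace.mk' ℝ (E := Bundle.Trivial Mbar ℝ) q (b.inner q
        ((trivializationAt E3 (TangentSpace (𝓡∂ 3)) p).symmL ℝ q (EuclideanSpace.single i (1 : ℝ)))
        ((trivializationAt E3 (TangentSpace (𝓡∂ 3)) p).symmL ℝ q
          (EuclideanSpace.single j (1 : ℝ))))) (chartAt H3 p).source :=
    ContMDiffOn.clm_bundle_apply₂ (F₁ := E3) (F₂ := E3) b.contMDiff.contMDiffOn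
      (contMDiffOn_coordFrame p i) (contMDiffOn_coordFrame p j)
  have h2 : ContMDiffOn (𝓡∂ 3) 𝓘(ℝ) ∞ (fun q => b.inner q
        ((trivializationAt E3 (TangentSpace (𝓡∂ 3)) p).symmL ℝ q (EuclideanSpace.single i (1 : ℝ)))
        ((trivializationAt E3 (TangentSpace (𝓡∂ 3)) p).symmL ℝ q
          (EuclideanSpace.single j (1 : ℝ)))) (chartAt H3 p).source := by
    intro q hq
    have h := h1 q hq
    simp only [Bundle.contMDiffWithinAt_totalSpace] at h
    exact h.2
  have h3 := h2.comp (contMDiffOn_extChartAt_symm (I := 𝓡∂ 3) (n := ∞) p)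
    (fun x hx => chartPoint_mem_source hx)
  rw [contMDiffOn_iff_contDiffOn] at h3
  refine h3.congr fun x hx => ?_
  simp only [bilinComp, Matrix.of_apply, coordVec_eq_symmL hx]
  rfl

theorem continuousOn_bilinComp (b : ContinuousMetric Mbar) (p : Mbar) (i j : Fin 3) :
    ContinuousOn (fun x => bilinComp b.inner (chartAt H3 p) x i j)
      ((chartAt H3 p).extend (𝓡∂ 3)).target := by
  have h1 : ContinuousOn
      (fun q => Bundle.TotalSpace.mk' ℝ (E := Bundle.Trivial Mbar ℝ) q (b.inner q
        ((trivializationAt E3 (TangentSpace (𝓡∂ 3)) p).symmL ℝ q (EuclideanSpace.single i (1 : ℝ)))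
        ((trivializationAt E3 (TangentSpace (𝓡∂ 3)) p).symmL ℝ q
          (EuclideanSpace.single j (1 : ℝ))))) (chartAt H3 p).source :=
    ContinuousOn.clm_bundle_apply₂ (F₁ := E3) (F₂ := E3) b.continuous.continuousOn
      (contMDiffOn_coordFrame p i).continuousOn (contMDiffOn_coordFrame p j).continuousOn
  have h2 : ContinuousOn (fun q => b.inner q
        ((trivializationAt E3 (TangentSpace (𝓡∂ 3)) p).symmL ℝ q (EuclideanSpace.single i (1 : ℝ)))
        ((trivializationAt E3 (TangentSpace (𝓡∂ 3)) p).symmL ℝ q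
          (EuclideanSpace.single j (1 : ℝ)))) (chartAt H3 p).source := by
    intro q hq
    have h := h1 q hq
    simp only [FiberBundle.continuousWithinAt_totalSpace] at h
    exact h.2
  have h3 := h2.comp (continuousOn_extChartAt_symm (I := 𝓡∂ 3) p)
    (fun x hx => chartPoint_mem_source hx)
  refine h3.congr fun x hx => ?_
  simp only [bilinComp, Matrix.of_apply, coordVec_eq_symmL hx]
  rfl

/-- The matrix of a positive definite form in a chart is positive definite, since the coordinate
vector fields are linearly independent. -/
theorem posDef_bilinComp {b : BilinField Mbar} {p : Mbar} {x : E3}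
    (hx : x ∈ ((chartAt H3 p).extend (𝓡∂ 3)).target)
    (hsymm : ∀ v w, b (chartPoint (chartAt H3 p) x) v w = b (chartPoint (chartAt H3 p) x) w v)
    (hpos : ∀ v, v ≠ 0 → 0 < b (chartPoint (chartAt H3 p) x) v v) :
    (bilinComp b (chartAt H3 p) x).PosDef := by
  let D : E3 →L[ℝ] TangentSpace (𝓡∂ 3) (chartPoint (chartAt H3 p) x) :=
    (trivializationAt E3 (TangentSpace (𝓡∂ 3)) p).symmL ℝ (chartPoint (chartAt H3 p) x)
  have hinj : Function.Injective D := fun v w h => by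
    have hb : chartPoint (chartAt H3 p) x ∈
        (trivializationAt E3 (TangentSpace (𝓡∂ 3)) p).baseSet := by
      rw [TangentBundle.trivializationAt_baseSet]
      exact chartPoint_mem_source hx
    have h2 := congrArg ((trivializationAt E3 (TangentSpace (𝓡∂ 3)) p).continuousLinearMapAt ℝ
      (chartPoint (chartAt H3 p) x)) h
    simpa only [D, Bundle.Trivialization.continuousLinearMapAt_symmL _ hb] using h2
  refine Matrix.PosDef.of_dotProduct_mulVec_pos ?_ fun v hv => ?_
  · ext i j
    simp [bilinComp, Matrix.conjTranspose_apply, hsymm]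
  · let w : E3 := WithLp.toLp 2 v
    have hw : w = ∑ i, v i • (EuclideanSpace.single i (1 : ℝ) : E3) := by
      ext j
      simp [w, Finset.sum_apply, Pi.single_apply]
    have hw0 : w ≠ 0 := fun h => hv (by
      have := congrArg (WithLp.ofLp) h
      simpa [w] using this)
    have hD0 : D w ≠ 0 := fun h => hw0 (hinj (by rw [map_zero]; exact h))
    have hDw : D w = ∑ i, v i • coordVec (chartAt H3 p) x i := by
      rw [hw, map_sum]
      exact Finset.sum_congr rfl fun i _ => by rw [map_smul, coordVec_eq_symmL hx]
    have := hpos (D w) hD0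
    rw [hDw] at this
    refine this.trans_eq ?_
    simp only [dotProduct, Matrix.mulVec, bilinComp, Matrix.of_apply, map_sum, map_smul,
      sum_apply, smul_apply, smul_eq_mul, star_trivial,
      Finset.mul_sum]
    rw [Finset.sum_comm]
    exact Finset.sum_congr rfl fun i _ => Finset.sum_congr rfl fun j _ => by ring

theorem vecComp_eq_zero_iff {X : VField Mbar} {p : Mbar} {x : E3}
    (hx : x ∈ ((chartAt H3 p).extend (𝓡∂ 3)).target) :
    (∀ i, vecComp X (chartAt H3 p) i x = 0) ↔ X (chartPoint (chartAt H3 p) x) = 0 := by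
  have hinv : (mfderiv (𝓡∂ 3) 𝓘(ℝ, E3) (extChartAt (𝓡∂ 3) p)
      (chartPoint (chartAt H3 p) x)).IsInvertible :=
    isInvertible_mfderiv_extChartAt (by rw [extChartAt_source]; exact chartPoint_mem_source hx)
  constructor
  · intro h
    refine hinv.injective ?_
    rw [map_zero]
    change (_ : E3) = (0 : E3)
    ext i
    exact h i
  · intro h i
    simp only [vecComp, h, map_zero]
    rfl

end Charts

/-! ### Functions smooth up to the boundary -/

theorem exists_uniform_bound {ι : Type*} [Finite ι] {K : Set E3} (hK : IsCompact K)
    {f : ι → E3 → ℝ} (hf : ∀ a, ContinuousOn (f a) K) : ∃ A, ∀ a, ∀ x ∈ K, |f a x| ≤ A := by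
  choose B hB using fun a => hK.exists_bound_of_continuousOn (hf a)
  obtain ⟨A, hA⟩ := (Set.finite_range B).bddAbove
  exact ⟨A, fun a x hx => (hB a x hx).trans (hA (Set.mem_range_self a))⟩

theorem scaledBound_of_contDiffOn {T K U : Set E3} (hT : UniqueDiffOn ℝ T) (hK : IsCompact K)
    (hKT : K ⊆ T) (hU : IsOpen U) (hUK : U ⊆ K) {τ : E3 → ℝ} (hτ : ∀ x ∈ U, 0 ≤ τ x ∧ τ x ≤ 1)
    {f : E3 → ℝ} (hf : ContDiffOn ℝ ∞ f T) : ScaledBound U τ f := by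
  let D : Fin 3 → (E3 → ℝ) → E3 → ℝ := fun i f x =>
    fderivWithin ℝ f T x (EuclideanSpace.single i (1 : ℝ))
  have hD : ∀ i {f : E3 → ℝ}, ContDiffOn ℝ ∞ f T → ContDiffOn ℝ ∞ (D i f) T := fun i f h =>
    (h.fderivWithin hT le_rfl).clm_apply contDiffOn_const
  have hpd : ∀ i (f : E3 → ℝ), Set.EqOn (pd i f) (D i f) U := fun i f x hx => by
    simp only [pd, D]
    rw [fderivWithin_of_mem_nhds (Filter.mem_of_superset (hU.mem_nhds hx) (hUK.trans hKT))]
  have hpd2 : ∀ i j (f : E3 → ℝ), Set.EqOn (pd i (pd j f)) (D i (D j f)) U := fun i j f x hx => by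
    rw [← hpd i _ hx]
    exact pd_congr_of_isOpen hU (hpd j f) i hx
  have hb : ∀ {f : E3 → ℝ}, ContDiffOn ℝ ∞ f T → ∃ C, ∀ x ∈ U, |f x| ≤ C := fun h => by
    obtain ⟨C, hC⟩ := hK.exists_bound_of_continuousOn (h.continuousOn.mono hKT)
    exact ⟨C, fun x hx => hC x (hUK hx)⟩
  obtain ⟨C0, hC0⟩ := hb hf
  choose C1 hC1 using fun i => hb (hD i hf)
  choose C2 hC2 using fun i j => hb (hD i (hD j hf))
  obtain ⟨A₁, hA₁⟩ := (Set.finite_range C1).bddAbove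
  obtain ⟨A₂, hA₂⟩ := (Set.finite_range fun a : Fin 3 × Fin 3 => C2 a.1 a.2).bddAbove
  refine ⟨(hf.mono (hUK.trans hKT)).of_le ENat.LEInfty.out, max C0 (max A₁ A₂), fun x hx => ?_⟩
  obtain ⟨ht, ht1⟩ := hτ x hx
  refine ⟨(hC0 x hx).trans (le_max_left _ _), fun i => ?_, fun i j => ?_⟩
  · rw [hpd i f hx]
    refine (mul_le_of_le_one_left (abs_nonneg _) ht1).trans ((hC1 i x hx).trans ?_)
    exact (hA₁ (Set.mem_range_self i)).trans ((le_max_left _ _).trans (le_max_right _ _))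
  · rw [hpd2 i j f hx]
    refine (mul_le_of_le_one_left (abs_nonneg _) (pow_le_one₀ ht ht1)).trans
      ((hC2 i j x hx).trans ?_)
    exact (hA₂ (Set.mem_range_self (i, j))).trans ((le_max_right _ _).trans (le_max_right _ _))

theorem scaledBound_pd_of_contDiffOn {T K U : Set E3} (hT : UniqueDiffOn ℝ T) (hK : IsCompact K)
    (hKT : K ⊆ T) (hU : IsOpen U) (hUK : U ⊆ K) {τ : E3 → ℝ} (hτ : ∀ x ∈ U, 0 ≤ τ x ∧ τ x ≤ 1)
    {f : E3 → ℝ} (hf : ContDiffOn ℝ ∞ f T) (k : Fin 3) : ScaledBound U τ (pd k f) := by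
  have h : ContDiffOn ℝ ∞ (fun x => fderivWithin ℝ f T x (EuclideanSpace.single k (1 : ℝ))) T :=
    (hf.fderivWithin hT le_rfl).clm_apply contDiffOn_const
  refine (scaledBound_of_contDiffOn hT hK hKT hU hUK hτ h).congr hU fun x hx => ?_
  simp only [pd]
  rw [fderivWithin_of_mem_nhds (Filter.mem_of_superset (hU.mem_nhds hx) (hUK.trans hKT))]

theorem contDiffOn_matrix_det {n : WithTop ℕ∞} {T : Set E3} {A : E3 → Matrix (Fin 3) (Fin 3) ℝ}
    (hA : ∀ i j, ContDiffOn ℝ n (fun x => A x i j) T) : ContDiffOn ℝ n (fun x => (A x).det) T := by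
  simp only [Matrix.det_apply']
  exact ContDiffOn.sum fun σ _ => contDiffOn_const.mul (contDiffOn_prod fun i _ => hA _ _)

theorem contDiffOn_matrix_inv {n : WithTop ℕ∞} {T : Set E3} {A : E3 → Matrix (Fin 3) (Fin 3) ℝ}
    (hA : ∀ i j, ContDiffOn ℝ n (fun x => A x i j) T) (hdet : ∀ x ∈ T, (A x).det ≠ 0)
    (i j : Fin 3) : ContDiffOn ℝ n (fun x => (A x)⁻¹ i j) T := by
  simp only [Matrix.inv_def, Ring.inverse_eq_inv', Matrix.smul_apply, smul_eq_mul,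
    Matrix.adjugate_apply]
  refine ((contDiffOn_matrix_det hA).inv hdet).mul (contDiffOn_matrix_det fun a b => ?_)
  by_cases h : a = j
  · simp only [h, Matrix.updateRow_self]
    exact contDiffOn_const
  · simp only [Matrix.updateRow_ne h]
    exact hA a b

theorem scaledBound_christoffel {T K U : Set E3} (hT : UniqueDiffOn ℝ T) (hK : IsCompact K)
    (hKT : K ⊆ T) (hU : IsOpen U) (hUK : U ⊆ K) {τ : E3 → ℝ} (hτ : ∀ x ∈ U, 0 ≤ τ x ∧ τ x ≤ 1)
    {G : E3 → Matrix (Fin 3) (Fin 3) ℝ} (hG : ∀ i j, ContDiffOn ℝ ∞ (fun x => G x i j) T)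
    (hdet : ∀ x ∈ T, (G x).det ≠ 0) (l k i : Fin 3) : ScaledBound U τ (christoffel G l k i) := by
  have hτ0 : ∀ x ∈ U, 0 ≤ τ x := fun x hx => (hτ x hx).1
  have hc : ∀ c : ℝ, ScaledBound U τ fun _ => c := fun c =>
    scaledBound_of_contDiffOn hT hK hKT hU hUK hτ contDiffOn_const
  have hp := fun k i j => scaledBound_pd_of_contDiffOn hT hK hKT hU hUK hτ (hG i j) k
  have hi := fun i j => scaledBound_of_contDiffOn hT hK hKT hU hUK hτ (contDiffOn_matrix_inv hG hdet i j)
  have h := (hc (1 / 2)).mul hU hτ0 (ScaledBound.sum hU hτ0 Finset.univ fun m =>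
    (hi l m).mul hU hτ0 (((hp k m i).add hU hτ0 (hp i k m)).add hU hτ0
      ((hc (-1)).mul hU hτ0 (hp m k i))))
  refine h.congr hU fun x _ => ?_
  simp only [christoffel]
  congr 1
  exact Finset.sum_congr rfl fun m _ => by ring

/-! ### Defining functions in coordinates -/

theorem convex_ball_inter_halfSpace (z : E3) (r : ℝ) :
    Convex ℝ (Metric.ball z r ∩ {x : E3 | 0 ≤ x 0}) :=
  (convex_ball z r).inter EuclideanHalfSpace.convex

theorem dist_sub_smul_single_le {z : E3} (hz : z 0 = 0) (x : E3) :
    dist (x - x 0 • (EuclideanSpace.single 0 (1 : ℝ) : E3)) z ≤ dist x z := by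
  rw [dist_eq_norm, dist_eq_norm, EuclideanSpace.norm_eq, EuclideanSpace.norm_eq]
  refine Real.sqrt_le_sqrt ?_
  simp only [Fin.sum_univ_three]
  simp [hz]
  positivity

/-- Near a boundary point, a nonnegative function on the half space that vanishes exactly to first
order on the boundary hyperplane is comparable with the coordinate `x₀`. -/
theorem exists_comparable_of_vanishing {R : E3 → ℝ} {T : Set E3} (hT : UniqueDiffOn ℝ T) {z : E3}
    (hz0 : z 0 = 0) {r₀ : ℝ} (hr₀ : 0 < r₀) (hball : Metric.ball z r₀ ∩ {x : E3 | 0 ≤ x 0} ⊆ T)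
    (hR : ContDiffOn ℝ 1 R T) (hRnn : ∀ x ∈ T, 0 ≤ R x) (hR0 : ∀ x ∈ T, x 0 = 0 → R x = 0)
    (hne : fderivWithin ℝ R T z ≠ 0) :
    ∃ r > 0, ∃ c > 0, ∃ C, ∀ x ∈ Metric.ball z r, 0 < x 0 → c * x 0 ≤ R x ∧ R x ≤ C * x 0 := by
  set e₀ : E3 := EuclideanSpace.single 0 (1 : ℝ) with he₀
  have hzb : z ∈ Metric.ball z r₀ ∩ {x : E3 | 0 ≤ x 0} := ⟨Metric.mem_ball_self hr₀, hz0.ge⟩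
  have hzT : z ∈ T := hball hzb
  set L := fderivWithin ℝ R T z with hL
  have hmin : IsLocalMinOn R T z := by
    filter_upwards [self_mem_nhdsWithin] with x hx
    rw [hR0 z hzT hz0]
    exact hRnn x hx
  have hcone : ∀ y : E3, ‖y‖ < r₀ → 0 ≤ y 0 → y ∈ posTangentConeAt T z := by
    intro y hy hy0
    refine mem_posTangentConeAt_of_segment_subset (Set.Subset.trans ?_ hball)
    refine (convex_ball_inter_halfSpace z r₀).segment_subset hzb ⟨?_, ?_⟩
    · simpa [Metric.mem_ball, dist_eq_norm] using hy
    · simpa [hz0] using hy0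
  have hscale : ∀ v : E3, ∃ ε : ℝ, 0 < ε ∧ ‖ε • v‖ < r₀ := fun v => by
    refine ⟨r₀ / (‖v‖ + 1), by positivity, ?_⟩
    rw [norm_smul, Real.norm_of_nonneg (by positivity), div_mul_eq_mul_div, div_lt_iff₀
      (by positivity)]
    nlinarith [norm_nonneg v]
  -- the boundary point is a minimum, so the tangential derivatives vanish there
  have htan : ∀ v : E3, v 0 = 0 → L v = 0 := by
    intro v hv
    obtain ⟨ε, hε, hεv⟩ := hscale v
    have h := hmin.fderivWithin_eq_zero (hcone (ε • v) hεv (by simp [hv]))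
      (hcone (-(ε • v)) (by rwa [norm_neg]) (by simp [hv]))
    rw [map_smul, smul_eq_mul] at h
    exact (mul_eq_zero.1 h).resolve_left hε.ne'
  have hnn : 0 ≤ L e₀ := by
    obtain ⟨ε, hε, hεv⟩ := hscale e₀
    have h := hmin.fderivWithin_nonneg (hcone (ε • e₀) hεv (by simp [he₀, hε.le]))
    rw [map_smul, smul_eq_mul] at h
    exact nonneg_of_mul_nonneg_right h hε
  have ha : 0 < L e₀ := by
    refine lt_of_le_of_ne hnn fun h => hne ?_
    ext v
    have hv : v = (v - v 0 • e₀) + v 0 • e₀ := by abel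
    rw [hv, map_add, htan _ (by simp [he₀]), map_smul, ← h]
    simp
  have hcont : ContinuousWithinAt (fun x => fderivWithin ℝ R T x e₀) T z :=
    ((hR.continuousOn_fderivWithin hT le_rfl).clm_apply continuousOn_const) z hzT
  have hev : ∀ᶠ x in 𝓝[T] z, fderivWithin ℝ R T x e₀ ∈ Set.Ioo (L e₀ / 2) (2 * L e₀) :=
    hcont (Ioo_mem_nhds (by linarith) (by linarith))
  obtain ⟨r₁, hr₁, hr₁b⟩ := Metric.mem_nhdsWithin_iff.1 hev
  refine ⟨min r₀ r₁, by positivity, L e₀ / 2, by positivity, 2 * L e₀, fun x hx hx0 => ?_⟩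
  have hxr : dist x z < min r₀ r₁ := hx
  set q : E3 := x - x 0 • e₀ with hq
  have hq0 : q 0 = 0 := by simp [hq, he₀]
  have hqz : q ∈ Metric.ball z (min r₀ r₁) := (dist_sub_smul_single_le hz0 x).trans_lt hxr
  have hpath : ∀ t ∈ Set.Icc 0 (x 0), q + t • e₀ ∈ Metric.ball z (min r₀ r₁) := by
    intro t ht
    have hx' : x = q + x 0 • e₀ := by rw [hq]; abel
    have hconv := (convex_ball z (min r₀ r₁)).add_smul_sub_mem hqz hx
      (t := t / x 0) ⟨div_nonneg ht.1 hx0.le, (div_le_one hx0).2 ht.2⟩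
    have e : x - q = x 0 • e₀ := by rw [hq]; abel
    rwa [e, smul_smul, div_mul_cancel₀ _ hx0.ne'] at hconv
  have hpath0 : ∀ t : ℝ, (q + t • e₀) 0 = t := fun t => by simp [hq0, he₀]
  have hpT : ∀ t ∈ Set.Icc 0 (x 0), q + t • e₀ ∈ T := fun t ht =>
    hball ⟨Metric.ball_subset_ball (min_le_left _ _) (hpath t ht), by
      change 0 ≤ (q + t • e₀) 0
      rw [hpath0]; exact ht.1⟩
  have hg : ContinuousOn (fun t : ℝ => R (q + t • e₀)) (Set.Icc 0 (x 0)) :=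
    hR.continuousOn.comp (by fun_prop) hpT
  have hd : ∀ t ∈ interior (Set.Icc 0 (x 0)),
      HasDerivAt (fun t : ℝ => R (q + t • e₀)) (fderivWithin ℝ R T (q + t • e₀) e₀) t := by
    intro t ht
    rw [interior_Icc] at ht
    have hmem : T ∈ 𝓝 (q + t • e₀) := by
      have ho : IsOpen (Metric.ball z r₀ ∩ {x : E3 | 0 < x 0}) :=
        Metric.isOpen_ball.inter (isOpen_lt continuous_const (by fun_prop))
      refine Filter.mem_of_superset (ho.mem_nhds ⟨Metric.ball_subset_ball (min_le_left _ _)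
        (hpath t ⟨ht.1.le, ht.2.le⟩), ?_⟩) fun y hy => hball ⟨hy.1, (show 0 < y 0 from hy.2).le⟩
      change 0 < (q + t • e₀) 0
      rw [hpath0]; exact ht.1
    rw [fderivWithin_of_mem_nhds hmem]
    have hdiff : DifferentiableAt ℝ R (q + t • e₀) :=
      (hR.contDiffAt hmem).differentiableAt (by norm_num)
    have h : HasDerivAt (fun t : ℝ => q + t • e₀) e₀ t := by
      simpa using ((hasDerivAt_id t).smul_const e₀).const_add q
    exact hdiff.hasFDerivAt.comp_hasDerivAt t h
  have hdb : ∀ t ∈ interior (Set.Icc 0 (x 0)),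
      deriv (fun t : ℝ => R (q + t • e₀)) t ∈ Set.Ioo (L e₀ / 2) (2 * L e₀) := by
    intro t ht
    rw [(hd t ht).deriv]
    have ht' := interior_subset ht
    exact hr₁b ⟨Metric.ball_subset_ball (min_le_right _ _) (hpath t ht'), hpT t ht'⟩
  have hdiff : DifferentiableOn ℝ (fun t : ℝ => R (q + t • e₀)) (interior (Set.Icc 0 (x 0))) :=
    fun t ht => (hd t ht).differentiableAt.differentiableWithinAt
  have h0m : (0 : ℝ) ∈ Set.Icc 0 (x 0) := ⟨le_rfl, hx0.le⟩
  have h1m : x 0 ∈ Set.Icc 0 (x 0) := ⟨hx0.le, le_rfl⟩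
  have hlow := (convex_Icc 0 (x 0)).mul_sub_le_image_sub_of_le_deriv hg hdiff
    (fun t ht => (hdb t ht).1.le) 0 h0m (x 0) h1m hx0.le
  have hup := (convex_Icc 0 (x 0)).image_sub_le_mul_sub_of_deriv_le hg hdiff
    (fun t ht => (hdb t ht).2.le) 0 h0m (x 0) h1m hx0.le
  have hxq : q + x 0 • e₀ = x := by rw [hq]; abel
  have hRq : R (q + (0 : ℝ) • e₀) = 0 := hR0 _ (hpT 0 h0m) (hpath0 0)
  simp only [hxq, hRq, sub_zero] at hlow hup
  exact ⟨hlow, hup⟩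

/-! ### Conformal invariance of the conformal Killing equation -/

/-- If `X` is a conformal Killing field of `Λ`, then the Lie derivative of `G = R² Λ` is a multiple
of `G`. -/
theorem exists_lieMetric_eq_mul {G Λ : E3 → Matrix (Fin 3) (Fin 3) ℝ} {R : E3 → ℝ}
    {X : Fin 3 → E3 → ℝ} {x : E3} (hG : ∀ y i j, G y i j = R y ^ 2 * Λ y i j)
    (hGd : ∀ i j, DifferentiableAt ℝ (fun y => G y i j) x) (hR : DifferentiableAt ℝ R x)
    (hRx : R x ≠ 0) (hΛ : ∀ i j, conformalKillingOp Λ X i j x = 0) :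
    ∃ c : ℝ, ∀ i j, lieMetric G X i j x = c * G x i j := by
  have hΛd : ∀ i j, DifferentiableAt ℝ (fun y => Λ y i j) x := by
    intro i j
    have h : DifferentiableAt ℝ (fun y => G y i j * (R y ^ 2)⁻¹) x :=
      (hGd i j).fun_mul ((hR.fun_pow 2).fun_inv (pow_ne_zero 2 hRx))
    refine h.congr_of_eventuallyEq ?_
    filter_upwards [hR.continuousAt.eventually_ne hRx] with y hy
    rw [hG]
    field_simp
  have hpd : ∀ k i j, pd k (fun y => G y i j) x =
      pd k (fun y => R y ^ 2) x * Λ x i j + R x ^ 2 * pd k (fun y => Λ y i j) x := by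
    intro k i j
    rw [← pd_mul (hR.fun_pow 2) (hΛd i j)]
    simp only [hG]
  refine ⟨(2 / 3) * divergence Λ X x + (∑ k, X k x * pd k (fun y => R y ^ 2) x) / R x ^ 2,
    fun i j => ?_⟩
  have h1 : lieMetric G X i j x = R x ^ 2 * lieMetric Λ X i j x +
      (∑ k, X k x * pd k (fun y => R y ^ 2) x) * Λ x i j := by
    simp only [lieMetric, hpd, Finset.mul_sum, Finset.sum_mul, ← Finset.sum_add_distrib]
    exact Finset.sum_congr rfl fun k _ => by rw [hG x k j, hG x i k]; ring
  have h2 : lieMetric Λ X i j x = (2 / 3) * divergence Λ X x * Λ x i j := by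
    have h := hΛ i j
    simp only [conformalKillingOp] at h
    linarith
  rw [h1, h2, hG]
  field_simp

/-! ### Weighted Hölder bounds near a point -/

section Manifold

variable {Mbar : Type*} [TopologicalSpace Mbar] [ChartedSpace H3 Mbar]

theorem MemWeightedHolder.scaledBound {ι : Type*} {ρ : Mbar → ℝ} {r : ℝ} {k : ℕ} {α : ℝ}
    {comp : OpenPartialHomeomorph Mbar H3 → ι → E3 → ℝ} (h : MemWeightedHolder ρ r k α r comp)
    (hk : 2 ≤ k) {e : OpenPartialHomeomorph Mbar H3}
    (he : e ∈ IsManifold.maximalAtlas (𝓡∂ 3) ∞ Mbar) (a : ι) {K : Set Mbar} (hK : IsCompact K)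
    (hKe : K ⊆ e.source) {U : Set E3} (hU : IsOpen U) (hUe : U ⊆ chartInterior e)
    (hUK : ∀ x ∈ U, chartPoint e x ∈ K) {τ : E3 → ℝ} {c : ℝ} (hc : 0 < c)
    (hτ : ∀ x ∈ U, 0 < τ x ∧ c * τ x ≤ ρ (chartPoint e x)) : ScaledBound U τ (comp e a) := by
  obtain ⟨hd, hb⟩ := h e he a
  have hd2 : ContDiffOn ℝ 2 (comp e a) U := (hd.mono hUe).of_le (by exact_mod_cast hk)
  obtain ⟨C, hC⟩ := hb K hK hKe
  have key : ∀ x ∈ U, ∀ j : ℕ, j ≤ k →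
      τ x ^ j * ‖iteratedFDeriv ℝ j (comp e a) x‖ ≤ |C| * c⁻¹ ^ j := by
    intro x hx j hj
    obtain ⟨ht, htρ⟩ := hτ x hx
    have hρ : 0 < ρ (chartPoint e x) := (mul_pos hc ht).trans_le htρ
    have h1 := (hC x (hUe hx) (hUK x hx)).1 j hj
    rw [show r - r - (j : ℝ) = -(j : ℝ) by ring, Real.rpow_neg hρ.le, Real.rpow_natCast] at h1
    have h2 : τ x ≤ c⁻¹ * ρ (chartPoint e x) := by
      rw [inv_mul_eq_div, le_div_iff₀ hc]; linarith
    have hρj : 0 < ρ (chartPoint e x) ^ j := pow_pos hρ j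
    calc _ ≤ (c⁻¹ * ρ (chartPoint e x)) ^ j * (|C| * (ρ (chartPoint e x) ^ j)⁻¹) := by
          gcongr
          exact h1.trans (by gcongr; exact le_abs_self C)
      _ = _ := by rw [mul_pow]; field_simp
  have hci : 0 < c⁻¹ := inv_pos.2 hc
  have q0 : 0 ≤ |C| * c⁻¹ ^ 0 := by positivity
  have q1 : 0 ≤ |C| * c⁻¹ ^ 1 := by positivity
  have q2 : 0 ≤ |C| * c⁻¹ ^ 2 := by positivity
  refine ⟨hd2, |C| * c⁻¹ ^ 0 + |C| * c⁻¹ ^ 1 + |C| * c⁻¹ ^ 2, fun x hx =>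
    ⟨?_, fun i => ?_, fun i j => ?_⟩⟩
  · have h1 := key x hx 0 (by lia)
    have h2 := abs_apply_le_norm_iteratedFDeriv (comp e a) x
    rw [pow_zero, one_mul] at h1
    linarith
  · have h1 := key x hx 1 (by lia)
    have h2 : τ x * |pd i (comp e a) x| ≤ τ x ^ 1 * ‖iteratedFDeriv ℝ 1 (comp e a) x‖ := by
      rw [pow_one]
      exact mul_le_mul_of_nonneg_left (abs_pd_le_norm_iteratedFDeriv _ _ _) (hτ x hx).1.le
    linarith
  · have h1 := key x hx 2 hk
    have h2 : τ x ^ 2 * |pd i (pd j (comp e a)) x| ≤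
        τ x ^ 2 * ‖iteratedFDeriv ℝ 2 (comp e a) x‖ :=
      mul_le_mul_of_nonneg_left
        (abs_pd_pd_le_norm_iteratedFDeriv (hd2.contDiffAt (hU.mem_nhds hx)) _ _) (sq_nonneg _)
    linarith

theorem IsDefiningFunction.fderivWithin_ne_zero {ρ : Mbar → ℝ} (hρ : IsDefiningFunction ρ)
    {p : Mbar} (hp : p ∈ (𝓡∂ 3).boundary Mbar) :
    fderivWithin ℝ (fun x => ρ (chartPoint (chartAt H3 p) x))
      ((chartAt H3 p).extend (𝓡∂ 3)).target (extChartAt (𝓡∂ 3) p p) ≠ 0 := by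
  have h := hρ.mfderiv_ne_zero p hp
  rw [((hρ.smooth.contMDiffAt (x := p)).mdifferentiableAt (by simp)).mfderiv] at h
  change fderivWithin ℝ (fun x => ρ (chartPoint (chartAt H3 p) x)) (extChartAt (𝓡∂ 3) p).target _ ≠ 0
  rw [fderivWithin_congr_set extChartAt_target_eventuallyEq]
  exact h

variable [IsManifold (𝓡∂ 3) ∞ Mbar]

theorem IsDefiningFunction.contDiffOn {ρ : Mbar → ℝ} (hρ : IsDefiningFunction ρ) (p : Mbar) :
    ContDiffOn ℝ ∞ (fun x => ρ (chartPoint (chartAt H3 p) x))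
      ((chartAt H3 p).extend (𝓡∂ 3)).target := by
  have h := hρ.smooth.comp_contMDiffOn (contMDiffOn_extChartAt_symm (I := 𝓡∂ 3) (n := ∞) p)
  rwa [contMDiffOn_iff_contDiffOn] at h

/-- Around every point there is a half ball in the chart on which `ρ` is bounded below by a multiple
of `min x₀ 1`, and, at boundary points, above by a multiple of `x₀`. -/
theorem IsDefiningFunction.exists_halfBall {ρ : Mbar → ℝ} (hρ : IsDefiningFunction ρ) (p : Mbar) :
    ∃ r > 0, Metric.closedBall (extChartAt (𝓡∂ 3) p p) r ∩ {x : E3 | 0 ≤ x 0} ⊆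
        ((chartAt H3 p).extend (𝓡∂ 3)).target ∧
      (∃ c > 0, ∀ x ∈ Metric.ball (extChartAt (𝓡∂ 3) p p) r, 0 < x 0 →
        c * min (x 0) 1 ≤ ρ (chartPoint (chartAt H3 p) x)) ∧
      (p ∈ (𝓡∂ 3).boundary Mbar → ∃ C, ∀ x ∈ Metric.ball (extChartAt (𝓡∂ 3) p p) r, 0 < x 0 →
        ρ (chartPoint (chartAt H3 p) x) ≤ C * x 0) := by
  set z := extChartAt (𝓡∂ 3) p p with hz
  set T := ((chartAt H3 p).extend (𝓡∂ 3)).target with hT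
  have hzT : z ∈ T := mem_extChartAt_target p
  have hzp : chartPoint (chartAt H3 p) z = p := extChartAt_to_inv p
  obtain ⟨r₀, hr₀, hr₀T⟩ : ∃ r₀ > 0, Metric.ball z r₀ ∩ {x : E3 | 0 ≤ x 0} ⊆ T := by
    have h : T ∈ 𝓝[Set.range (𝓡∂ 3)] z := extChartAt_target_mem_nhdsWithin p
    rw [range_modelWithCornersEuclideanHalfSpace] at h
    exact Metric.mem_nhdsWithin_iff.1 h
  have hsub : ∀ r, r < r₀ → Metric.closedBall z r ∩ {x : E3 | 0 ≤ x 0} ⊆ T := fun r hr =>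
    (Set.inter_subset_inter_left _ (Metric.closedBall_subset_ball hr)).trans hr₀T
  by_cases hp : p ∈ (𝓡∂ 3).boundary Mbar
  · have hz0 : z 0 = 0 := by rwa [← chartPoint_mem_boundary_iff hzT, hzp]
    obtain ⟨r, hr, c, hc, C, hcC⟩ := exists_comparable_of_vanishing
      (uniqueDiffOn_extChartAt_target p) hz0 hr₀ hr₀T
      ((hρ.contDiffOn p).of_le (by norm_cast)) (fun x _ => hρ.nonneg _)
      (fun x hx hx0 => (hρ.zero_iff _).2 ((chartPoint_mem_boundary_iff hx).2 hx0))
      (hρ.fderivWithin_ne_zero hp)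
    refine ⟨min (r₀ / 2) r, by positivity, hsub _ (by
      have := min_le_left (r₀ / 2) r; linarith), ⟨c, hc, fun x hx hx0 => ?_⟩,
      fun _ => ⟨C, fun x hx hx0 => ?_⟩⟩
    · refine le_trans ?_ (hcC x (Metric.ball_subset_ball (min_le_right _ _) hx) hx0).1
      gcongr
      exact min_le_left _ _
    · exact (hcC x (Metric.ball_subset_ball (min_le_right _ _) hx) hx0).2
  · have hρp : 0 < ρ p := lt_of_le_of_ne (hρ.nonneg p) fun h => hp ((hρ.zero_iff p).1 h.symm)
    have hcont : ContinuousWithinAt (fun x => ρ (chartPoint (chartAt H3 p) x)) T z :=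
      (hρ.contDiffOn p).continuousOn z hzT
    have hev : ∀ᶠ x in 𝓝[T] z, ρ p / 2 < ρ (chartPoint (chartAt H3 p) x) := by
      refine hcont (Ioi_mem_nhds (?_ : _ < ρ (chartPoint (chartAt H3 p) z)))
      rw [hzp]; linarith
    obtain ⟨r₁, hr₁, hr₁b⟩ := Metric.mem_nhdsWithin_iff.1 hev
    refine ⟨min (r₀ / 2) r₁, by positivity, hsub _ (by
      have := min_le_left (r₀ / 2) r₁; linarith), ⟨ρ p / 2, by positivity, fun x hx hx0 => ?_⟩,
      fun h => absurd h hp⟩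
    have hxT : x ∈ T := hr₀T ⟨Metric.ball_subset_ball ((min_le_left _ _).trans (by linarith)) hx,
      hx0.le⟩
    have h1 : ρ p / 2 < ρ (chartPoint (chartAt H3 p) x) :=
      hr₁b ⟨Metric.ball_subset_ball (min_le_right _ _) hx, hxT⟩
    have h2 : ρ p / 2 * min (x 0) 1 ≤ ρ p / 2 * 1 := by
      gcongr
      exact min_le_right _ _
    linarith

end Manifold

/-! ### The differential inequality near a point of the manifold -/

section Manifold

variable {Mbar : Type*} [TopologicalSpace Mbar] [ChartedSpace H3 Mbar]

/-- The half ball of radius `r` about the point `p`, in the preferred chart at `p`. -/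
def halfBall (p : Mbar) (r : ℝ) : Set E3 :=
  Metric.ball (extChartAt (𝓡∂ 3) p p) r ∩ {x | 0 < x 0}

theorem isOpen_halfBall (p : Mbar) (r : ℝ) : IsOpen (halfBall p r) :=
  Metric.isOpen_ball.inter (isOpen_lt continuous_const (by fun_prop))

variable [IsManifold (𝓡∂ 3) ∞ Mbar]

/-- Near any point, a conformal Killing field `X` of a weakly asymptotically hyperbolic metric
satisfies `|∂³X| ≤ C (|∂²X| + τ⁻¹ |∂X| + τ⁻² |X|)`, where `τ = min x₀ 1`. The first derivatives of
the compactified metric are uniformly `C²` in rescaled coordinates, because they differ from its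
covariant derivatives by products of its components with Christoffel symbols that are smooth up to
the boundary. -/
theorem exists_local_third_derivative_bound {ρ : Mbar → ℝ} (hρ : IsDefiningFunction ρ)
    {hbar : SmoothMetric Mbar} {α : ℝ} {g : BilinField Mbar} (hg : IsWeaklyAH ρ hbar 3 α g)
    {X : VField Mbar} {δ : ℝ} (hX : VectorHolder ρ 3 α δ X) (hXK : IsConformalKilling g X)
    {p : Mbar} {r : ℝ}
    (hr : Metric.closedBall (extChartAt (𝓡∂ 3) p p) r ∩ {x : E3 | 0 ≤ x 0} ⊆
        ((chartAt H3 p).extend (𝓡∂ 3)).target)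
    {c : ℝ} (hc : 0 < c) (hcρ : ∀ x ∈ Metric.ball (extChartAt (𝓡∂ 3) p p) r, 0 < x 0 →
        c * min (x 0) 1 ≤ ρ (chartPoint (chartAt H3 p) x)) :
    ∃ C, 0 ≤ C ∧ ∀ x ∈ halfBall p r, ∀ N, JetBound (vecComp X (chartAt H3 p)) (min (x 0) 1) N x →
      ∀ k i l m, |pd i (pd l (pd m (vecComp X (chartAt H3 p) k))) x| ≤ C * N := by
  set e := chartAt H3 p with he
  set T := (e.extend (𝓡∂ 3)).target with hT
  have heA : e ∈ IsManifold.maximalAtlas (𝓡∂ 3) ∞ Mbar := IsManifold.chart_mem_maximalAtlas p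
  set K : Set E3 := Metric.closedBall (extChartAt (𝓡∂ 3) p p) r ∩ {x : E3 | 0 ≤ x 0} with hKdef
  have hK : IsCompact K :=
    (isCompact_closedBall _ _).inter_right (isClosed_le continuous_const (by fun_prop))
  have hU := isOpen_halfBall p r
  have hUK : halfBall p r ⊆ K := fun x hx =>
    ⟨Metric.ball_subset_closedBall hx.1, (show 0 < x 0 from hx.2).le⟩
  have hUe : halfBall p r ⊆ chartInterior e := fun x hx => ⟨hr (hUK hx), hx.2⟩
  have hKbar : IsCompact (chartPoint e '' K) :=
    hK.image_of_continuousOn ((continuousOn_extChartAt_symm (I := 𝓡∂ 3) p).mono hr)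
  have hKbare : chartPoint e '' K ⊆ e.source := by
    rintro _ ⟨x, hx, rfl⟩
    exact chartPoint_mem_source (hr hx)
  have hUKbar : ∀ x ∈ halfBall p r, chartPoint e x ∈ chartPoint e '' K := fun x hx =>
    ⟨x, hUK hx, rfl⟩
  have hTu : UniqueDiffOn ℝ T := uniqueDiffOn_extChartAt_target p
  have hτ : ∀ x ∈ halfBall p r, 0 < min (x 0) 1 ∧ min (x 0) 1 ≤ 1 := fun x hx =>
    ⟨lt_min hx.2 one_pos, min_le_right _ _⟩
  have hτ' : ∀ x ∈ halfBall p r, 0 ≤ min (x 0) 1 ∧ min (x 0) 1 ≤ 1 := fun x hx =>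
    ⟨(hτ x hx).1.le, (hτ x hx).2⟩
  have hτ0 : ∀ x ∈ halfBall p r, 0 ≤ min (x 0) 1 := fun x hx => (hτ' x hx).1
  have hτρ : ∀ x ∈ halfBall p r, 0 < min (x 0) 1 ∧ c * min (x 0) 1 ≤ ρ (chartPoint e x) :=
    fun x hx => ⟨(hτ x hx).1, hcρ x hx.1 hx.2⟩
  -- the compactified metric and its continuous extension
  obtain ⟨G, hGg, -⟩ := hg.extends_to_boundary
  have hGe : ∀ x ∈ halfBall p r, bilinComp (compactify ρ g) e x = bilinComp G.inner e x := by
    intro x hx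
    simp only [bilinComp]
    rw [hGg _ ((chartPoint_mem_interior_iff (hr (hUK hx))).2 hx.2)]
  have hGpos : ∀ x ∈ T, (bilinComp G.inner e x).PosDef := fun x hx =>
    posDef_bilinComp hx (G.symm _) (G.pos _)
  have hG0 : ∀ i j, ContDiffOn ℝ 0 (fun x => bilinComp G.inner e x i j) T := fun i j =>
    contDiffOn_zero.2 (continuousOn_bilinComp G p i j)
  have hG00 : ∀ x ∈ T, bilinComp G.inner e x 0 0 ≠ 0 := fun x hx => (hGpos x hx).diag_pos.ne'
  obtain ⟨A₁, hA₁⟩ := exists_uniform_bound hK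
    (f := fun (a : Fin 3 × Fin 3) x => bilinComp G.inner e x a.1 a.2)
    fun a => (hG0 a.1 a.2).continuousOn.mono hr
  obtain ⟨A₂, hA₂⟩ := exists_uniform_bound hK
    (f := fun (a : Fin 3 × Fin 3) x => (bilinComp G.inner e x)⁻¹ a.1 a.2)
    fun a => (contDiffOn_matrix_inv hG0 (fun x hx => (hGpos x hx).det_pos.ne')
      a.1 a.2).continuousOn.mono hr
  obtain ⟨A₃, hA₃⟩ := hK.exists_bound_of_continuousOn
    (((hG0 0 0).inv hG00).continuousOn.mono hr)
  have hgC : ∀ i j, ContDiffOn ℝ 3 (fun x => bilinComp (compactify ρ g) e x i j)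
      (chartInterior e) := fun i j => (hg.regular.1 e heA (i, j)).1
  have hXC : ∀ k, ContDiffOn ℝ 3 (vecComp X e k) (chartInterior e) := fun k => (hX e heA k).1
  have hgS : ∀ i j, ScaledBound (halfBall p r) (fun x => min (x 0) 1)
      (fun x => bilinComp (compactify ρ g) e x i j) := fun i j =>
    hg.regular.1.scaledBound (by norm_num) heA (i, j) hKbar hKbare hU hUe hUKbar hc hτρ
  have hcS : ∀ k i j, ScaledBound (halfBall p r) (fun x => min (x 0) 1)
      (covDeriv2 (bilinComp hbar.inner e) (bilinComp (compactify ρ g) e) k i j) := fun k i j =>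
    hg.regular.2.scaledBound (by norm_num) heA (k, i, j) hKbar hKbare hU hUe hUKbar hc hτρ
  have hΓ : ∀ l k i, ScaledBound (halfBall p r) (fun x => min (x 0) 1)
      (christoffel (bilinComp hbar.inner e) l k i) :=
    scaledBound_christoffel hTu hK hr hU hUK hτ' (contDiffOn_bilinComp hbar p)
      fun x hx => (posDef_bilinComp hx (hbar.symm _) (hbar.pos _)).det_pos.ne'
  have hdg : ∀ k i j, ScaledBound (halfBall p r) (fun x => min (x 0) 1)
      (pd k fun y => bilinComp (compactify ρ g) e y i j) := by
    intro k i j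
    refine (((hcS k i j).add hU hτ0 (ScaledBound.sum hU hτ0 Finset.univ fun l =>
      (hΓ l k i).mul hU hτ0 (hgS l j))).add hU hτ0 (ScaledBound.sum hU hτ0 Finset.univ fun l =>
      (hΓ l k j).mul hU hτ0 (hgS i l))).congr hU fun x _ => ?_
    simp only [covDeriv2]
    ring
  have hgsymm : ∀ x ∈ halfBall p r, ∀ i j, bilinComp (compactify ρ g) e x i j =
      bilinComp (compactify ρ g) e x j i := fun x hx i j => by
    simp only [bilinComp, Matrix.of_apply, compactify, smul_apply]
    rw [hg.symm _ ((chartPoint_mem_interior_iff (hr (hUK hx))).2 hx.2)]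
  have hL : ∀ x ∈ halfBall p r, ∃ c : ℝ, ∀ i j,
      lieMetric (bilinComp (compactify ρ g) e) (vecComp X e) i j x =
        c * bilinComp (compactify ρ g) e x i j := by
    intro x hx
    have hxe := hUe hx
    refine exists_lieMetric_eq_mul (Λ := bilinComp g e) (R := fun x => ρ (chartPoint e x))
      (fun y i j => ?_) (fun i j => ?_) ?_ ?_ (hXK e heA x hxe)
    · simp [bilinComp, compactify]
    · exact ((hgC i j).contDiffAt ((isOpen_chartInterior e).mem_nhds hxe)).differentiableAt
        (by norm_num)
    · exact ((hρ.contDiffOn p).contDiffAt (Filter.mem_of_superset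
        ((isOpen_chartInterior e).mem_nhds hxe) (chartInterior_subset_target e))).differentiableAt
        (by simp)
    · exact ((mul_pos hc (hτ x hx).1).trans_le (hcρ x hx.1 hx.2)).ne'
  obtain ⟨C, hC⟩ := exists_third_derivative_bound hU hτ (A := max A₁ (max A₂ A₃))
    (fun i j => (hgC i j).mono hUe) hgsymm
    (fun x hx i j => by
      rw [hGe x hx]
      exact (hA₁ (i, j) x (hUK hx)).trans (le_max_left _ _))
    (fun x hx => by
      rw [hGe x hx]
      exact (hGpos x (hr (hUK hx))).det_pos.ne'.isUnit)
    (fun x hx i j => by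
      rw [hGe x hx]
      exact (hA₂ (i, j) x (hUK hx)).trans ((le_max_left _ _).trans (le_max_right _ _)))
    (fun x hx => by
      rw [hGe x hx]
      exact ⟨hG00 x (hr (hUK hx)), (hA₃ x (hUK hx)).trans
        ((le_max_right _ _).trans (le_max_right _ _))⟩)
    hdg (fun k => (hXC k).mono hUe) hL
  refine ⟨|C|, abs_nonneg C, fun x hx N hN k i l m => (hC x hx N hN k i l m).trans ?_⟩
  have hN0 : 0 ≤ N := (abs_nonneg _).trans (hN.2.2 0 0 0)
  gcongr
  exact le_abs_self C

end Manifold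

/-! ### Vanishing near the boundary and propagation into the interior -/

section Manifold

variable {Mbar : Type*} [TopologicalSpace Mbar] [ChartedSpace H3 Mbar] [IsManifold (𝓡∂ 3) ∞ Mbar]

/-- Near a boundary point, `X` vanishes: it decays together with its first two derivatives along the
lines orthogonal to the boundary of the chart, at a rate of positive order. -/
theorem exists_halfBall_eq_zero_of_boundary {ρ : Mbar → ℝ} (hρ : IsDefiningFunction ρ)
    {hbar : SmoothMetric Mbar} {α : ℝ} {g : BilinField Mbar} (hg : IsWeaklyAH ρ hbar 3 α g)
    {X : VField Mbar} {δ : ℝ} (hδ : 1 < δ) (hX : VectorHolder ρ 3 α δ X)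
    (hXK : IsConformalKilling g X) {p : Mbar} (hp : p ∈ (𝓡∂ 3).boundary Mbar) :
    ∃ ε > 0, ∀ x ∈ halfBall p ε, ∀ k, vecComp X (chartAt H3 p) k x = 0 := by
  obtain ⟨r, hr, hrT, ⟨c, hc, hcρ⟩, hup⟩ := hρ.exists_halfBall p
  obtain ⟨A, hA⟩ := hup hp
  obtain ⟨C, hC0, hC⟩ := exists_local_third_derivative_bound hρ hg hX hXK hrT hc hcρ
  set e := chartAt H3 p with he
  set z := extChartAt (𝓡∂ 3) p p with hz
  have hzp : chartPoint e z = p := extChartAt_to_inv p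
  have hz0 : z 0 = 0 := by
    rwa [← chartPoint_mem_boundary_iff (mem_extChartAt_target p), hzp]
  have heA : e ∈ IsManifold.maximalAtlas (𝓡∂ 3) ∞ Mbar := IsManifold.chart_mem_maximalAtlas p
  set K : Set E3 := Metric.closedBall z r ∩ {x : E3 | 0 ≤ x 0} with hKdef
  have hK : IsCompact K :=
    (isCompact_closedBall _ _).inter_right (isClosed_le continuous_const (by fun_prop))
  have hUK : halfBall p r ⊆ K := fun x hx =>
    ⟨Metric.ball_subset_closedBall hx.1, (show 0 < x 0 from hx.2).le⟩
  have hUe : halfBall p r ⊆ chartInterior e := fun x hx => ⟨hrT (hUK hx), hx.2⟩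
  have hXC : ∀ k, ContDiffOn ℝ 3 (vecComp X e k) (halfBall p r) := fun k =>
    (hX e heA k).1.mono hUe
  choose B hB using fun k => (hX e heA k).2 (chartPoint e '' K)
    (hK.image_of_continuousOn ((continuousOn_extChartAt_symm (I := 𝓡∂ 3) p).mono hrT))
    (by rintro _ ⟨x, hx, rfl⟩; exact chartPoint_mem_source (hrT hx))
  obtain ⟨B', hB'⟩ := (Set.finite_range B).bddAbove
  -- the decay of `X` and its derivatives, in terms of `x₀`
  let M : ℝ := |B'| * ∑ j ∈ Finset.range 3, |A| ^ (δ - -1 - (j : ℝ))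
  have hdecay : ∀ x ∈ halfBall p r, ∀ k, ∀ j : ℕ, j ≤ 2 →
      ‖iteratedFDeriv ℝ j (vecComp X e k) x‖ ≤ M * x 0 ^ (δ - -1 - (j : ℝ)) := by
    intro x hx k j hj
    have hx0 : 0 < x 0 := hx.2
    have h := (hB k x (hUe hx) ⟨x, hUK hx, rfl⟩).1 j (by lia)
    have hj' : (j : ℝ) ≤ 2 := by exact_mod_cast hj
    have hexp : 0 ≤ δ - -1 - (j : ℝ) := by linarith
    have hρ0 : 0 ≤ ρ (chartPoint e x) := hρ.nonneg _
    have hsum : |A| ^ (δ - -1 - (j : ℝ)) ≤ ∑ j ∈ Finset.range 3, |A| ^ (δ - -1 - (j : ℝ)) :=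
      Finset.single_le_sum (f := fun j : ℕ => |A| ^ (δ - -1 - (j : ℝ)))
        (fun _ _ => by positivity) (Finset.mem_range.2 (by lia))
    calc _ ≤ B k * ρ (chartPoint e x) ^ (δ - -1 - (j : ℝ)) := h
      _ ≤ |B'| * (|A| * x 0) ^ (δ - -1 - (j : ℝ)) := by
          gcongr
          · exact (hB' (Set.mem_range_self k)).trans (le_abs_self _)
          · exact (hA x hx.1 hx.2).trans (by gcongr; exact le_abs_self A)
      _ = |B'| * |A| ^ (δ - -1 - (j : ℝ)) * x 0 ^ (δ - -1 - (j : ℝ)) := by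
          rw [Real.mul_rpow (abs_nonneg _) hx0.le]; ring
      _ ≤ _ := by
          simp only [M]
          gcongr
  let T : ℝ := min 1 (min (r / 2) (1 / (54 * C + 1)))
  have hT0 : 0 < T := by positivity
  have hT1 : T ≤ 1 := min_le_left _ _
  have hTr : T ≤ r / 2 := (min_le_right _ _).trans (min_le_left _ _)
  have hCT : 54 * C * T ≤ 1 := by
    have h : T ≤ 1 / (54 * C + 1) := (min_le_right _ _).trans (min_le_right _ _)
    rw [le_div_iff₀ (by positivity)] at h
    nlinarith
  refine ⟨T, hT0, fun x hx k => ?_⟩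
  set e₀ : E3 := EuclideanSpace.single 0 (1 : ℝ) with he₀
  have hxz : dist x z < T := hx.1
  have hx0 : 0 < x 0 := hx.2
  have hxT : x 0 < T := by
    refine lt_of_le_of_lt ?_ hxz
    have h := PiLp.norm_apply_le (x - z) 0
    rw [← dist_eq_norm] at h
    refine le_trans ?_ h
    simp [hz0, le_abs_self]
  set q : E3 := x - x 0 • e₀ with hq
  have hpath0 : ∀ t : ℝ, (q + t • e₀) 0 = t := fun t => by simp [hq, he₀]
  have hpath : ∀ t ∈ Set.Ioo 0 T, q + t • e₀ ∈ halfBall p r := by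
    intro t ht
    refine ⟨?_, ?_⟩
    · have h1 : dist (q + t • e₀) q = t := by
        rw [dist_eq_norm, add_sub_cancel_left, norm_smul, Real.norm_of_nonneg ht.1.le]
        simp [he₀]
      have h2 := dist_triangle (q + t • e₀) q z
      have h3 : dist q z < T := (dist_sub_smul_single_le hz0 x).trans_lt hxz
      change dist _ _ < r
      linarith [ht.2]
    · change 0 < (q + t • e₀) 0
      rw [hpath0]; exact ht.1
  have key := eq_zero_along_ray (isOpen_halfBall p r) hXC hC0 hC (q := q) (v := e₀)
    (fun i => by by_cases h : i = 0 <;> simp [he₀, h]) (T := T) (s := δ - 1) (N := M)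
    (by linarith) hCT
    (fun t ht => ⟨hpath t ht, by rw [hpath0]; exact le_min le_rfl (ht.2.le.trans hT1)⟩)
    (fun t ht => by
      have hU := hpath t ht
      have hd := hdecay _ hU
      simp only [hpath0] at hd
      refine ⟨fun k => ?_, fun k i => ?_, fun k i j => ?_⟩
      · refine (abs_apply_le_norm_iteratedFDeriv _ _).trans ((hd k 0 (by norm_num)).trans_eq ?_)
        congr 2; push_cast; ring
      · refine (abs_pd_le_norm_iteratedFDeriv _ _ _).trans ((hd k 1 (by norm_num)).trans_eq ?_)
        congr 2; push_cast; ring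
      · refine (abs_pd_pd_le_norm_iteratedFDeriv (((hXC k).contDiffAt
          ((isOpen_halfBall p r).mem_nhds hU)).of_le (by norm_num)) _ _).trans
            ((hd k 2 le_rfl).trans_eq ?_)
        congr 2; push_cast; ring)
    (x 0) ⟨hx0, hxT⟩ k
  have hxq : q + x 0 • e₀ = x := by rw [hq]; abel
  rwa [hxq] at key

/-- Near an interior point `X` has the unique continuation property, with a radius that does not
depend on the point about which `X` is assumed to vanish. -/
theorem exists_ball_unique_continuation {ρ : Mbar → ℝ} (hρ : IsDefiningFunction ρ)
    {hbar : SmoothMetric Mbar} {α : ℝ} {g : BilinField Mbar} (hg : IsWeaklyAH ρ hbar 3 α g)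
    {X : VField Mbar} {δ : ℝ} (hX : VectorHolder ρ 3 α δ X)
    (hXK : IsConformalKilling g X) {p : Mbar} (hp : p ∈ (𝓡∂ 3).interior Mbar) :
    ∃ ε > 0, Metric.ball (extChartAt (𝓡∂ 3) p p) ε ⊆ chartInterior (chartAt H3 p) ∧
      ∀ q ∈ Metric.ball (extChartAt (𝓡∂ 3) p p) ε,
        (∀ᶠ y in 𝓝 q, ∀ k, vecComp X (chartAt H3 p) k y = 0) →
        ∀ x ∈ Metric.ball (extChartAt (𝓡∂ 3) p p) ε, ∀ k, vecComp X (chartAt H3 p) k x = 0 := by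
  obtain ⟨r, hr, hrT, ⟨c, hc, hcρ⟩, -⟩ := hρ.exists_halfBall p
  obtain ⟨C, hC0, hC⟩ := exists_local_third_derivative_bound hρ hg hX hXK hrT hc hcρ
  set e := chartAt H3 p with he
  set z := extChartAt (𝓡∂ 3) p p with hz
  have hzp : chartPoint e z = p := extChartAt_to_inv p
  have hz0 : 0 < z 0 := by
    rwa [← chartPoint_mem_interior_iff (mem_extChartAt_target p), hzp]
  have heA : e ∈ IsManifold.maximalAtlas (𝓡∂ 3) ∞ Mbar := IsManifold.chart_mem_maximalAtlas p
  have hU := isOpen_halfBall p r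
  have hUe : halfBall p r ⊆ chartInterior e := fun x hx =>
    ⟨hrT ⟨Metric.ball_subset_closedBall hx.1, (show 0 < x 0 from hx.2).le⟩, hx.2⟩
  have hXC : ∀ k, ContDiffOn ℝ 3 (vecComp X e k) (halfBall p r) := fun k =>
    (hX e heA k).1.mono hUe
  let m : ℝ := min (z 0 / 2) 1
  have hm : 0 < m := by positivity
  let R : ℝ := min (r / 2) m
  have hR : 0 < R := by positivity
  have hRr : R ≤ r / 2 := min_le_left _ _
  have hRm : R ≤ m := min_le_right _ _
  have hlow : ∀ x ∈ Metric.closedBall z R, m ≤ min (x 0) 1 := by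
    intro x hx
    have h := PiLp.norm_apply_le (x - z) 0
    rw [← dist_eq_norm] at h
    have h1 : |x 0 - z 0| ≤ R := le_trans (by simpa using h) hx
    have h2 : m ≤ z 0 / 2 := min_le_left _ _
    exact le_min (by linarith [(abs_le.1 h1).1]) (min_le_right _ _)
  have hRU : Metric.closedBall z R ⊆ halfBall p r := fun x hx =>
    ⟨Metric.closedBall_subset_ball (by linarith) hx,
      hm.trans_le ((hlow x hx).trans (min_le_left _ _))⟩
  have hK : IsCompact (Metric.closedBall z R) := isCompact_closedBall _ _
  have c2 : ∀ k i, ContDiffOn ℝ 2 (pd i (vecComp X e k)) (halfBall p r) := fun k i =>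
    contDiffOn_pd (n := 2) hU (hXC k) i
  obtain ⟨B₀, hB₀⟩ := exists_uniform_bound hK (f := vecComp X e)
    fun k => (hXC k).continuousOn.mono hRU
  obtain ⟨B₁, hB₁⟩ := exists_uniform_bound hK
    (f := fun (a : Fin 3 × Fin 3) => pd a.1 (vecComp X e a.2))
    fun a => (c2 a.2 a.1).continuousOn.mono hRU
  obtain ⟨B₂, hB₂⟩ := exists_uniform_bound hK
    (f := fun (a : Fin 3 × Fin 3 × Fin 3) => pd a.1 (pd a.2.1 (vecComp X e a.2.2)))
    fun a => (contDiffOn_pd (n := 1) hU (c2 a.2.2 a.2.1) a.1).continuousOn.mono hRU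
  let B : ℝ := max B₀ (max B₁ B₂)
  have hB0 : 0 ≤ B := ((abs_nonneg _).trans (hB₀ 0 z (Metric.mem_closedBall_self hR.le))).trans
    (le_max_left _ _)
  let T : ℝ := min (R / 2) (1 / (54 * C + 1))
  have hT0 : 0 < T := by positivity
  have hTR : T ≤ R / 2 := min_le_left _ _
  have hT1 : T ≤ 1 := by
    have : m ≤ 1 := min_le_right _ _
    linarith
  have hCT : 54 * C * T ≤ 1 := by
    have h : T ≤ 1 / (54 * C + 1) := min_le_right _ _
    rw [le_div_iff₀ (by positivity)] at h
    nlinarith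
  refine ⟨T / 2, by positivity, fun x hx => hUe (hRU (Metric.ball_subset_closedBall
    (Metric.ball_subset_ball (by linarith) hx))), fun q hq hzero x hx k => ?_⟩
  rcases eq_or_ne x q with rfl | hxq
  · exact hzero.self_of_nhds k
  have hd0 : 0 < dist x q := dist_pos.2 hxq
  have hqz : dist q z < T / 2 := hq
  have hdT : dist x q < T := by
    have h1 := dist_triangle_right x q z
    have h2 : dist x z < T / 2 := hx
    linarith
  let v : E3 := (dist x q)⁻¹ • (x - q)
  have hvn : ‖v‖ = 1 := by
    simp only [v, norm_smul, norm_inv, Real.norm_of_nonneg hd0.le, ← dist_eq_norm]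
    exact inv_mul_cancel₀ hd0.ne'
  have hdist : ∀ t ∈ Set.Ioo 0 T, dist (q + t • v) q = t := fun t ht => by
    rw [dist_eq_norm, add_sub_cancel_left, norm_smul, hvn, Real.norm_of_nonneg ht.1.le, mul_one]
  have hpath : ∀ t ∈ Set.Ioo 0 T, q + t • v ∈ Metric.closedBall z R := by
    intro t ht
    have h1 := hdist t ht
    have h2 := dist_triangle (q + t • v) q z
    change dist _ _ ≤ R
    linarith [ht.2]
  obtain ⟨η', hη', hzero'⟩ := Metric.eventually_nhds_iff_ball.1 hzero
  let η : ℝ := min η' 1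
  have hη : 0 < η := by positivity
  have hη1 : η ≤ 1 := min_le_right _ _
  have hN0 : 0 ≤ B / η ^ 3 := by positivity
  -- close to `q` the jet vanishes, further away `t` is bounded below
  have hnear : ∀ t ∈ Set.Ioo 0 T, t < η → ∀ k,
      vecComp X e k =ᶠ[𝓝 (q + t • v)] fun _ => 0 := by
    intro t ht htη k
    have hmem : q + t • v ∈ Metric.ball q η' := by
      rw [Metric.mem_ball, hdist t ht]
      exact htη.trans_le (min_le_left _ _)
    filter_upwards [Metric.isOpen_ball.mem_nhds hmem] with y hy
    exact hzero' y hy k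
  have hpd0 : ∀ i : Fin 3, pd i (fun _ : E3 => (0 : ℝ)) = fun _ => 0 := fun i => by
    funext x; simp [pd]
  have hfar : ∀ t ∈ Set.Ioo 0 T, η ≤ t → ∀ a : ℝ, a ≤ 3 → B ≤ B / η ^ 3 * t ^ a := by
    intro t ht hηt a ha
    have h1 : η ^ 3 ≤ t ^ a := by
      calc η ^ 3 ≤ t ^ 3 := by gcongr
        _ = t ^ (3 : ℝ) := by norm_cast
        _ ≤ t ^ a := Real.rpow_le_rpow_of_exponent_ge ht.1 (ht.2.le.trans hT1) ha
    calc B = B / η ^ 3 * η ^ 3 := by field_simp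
      _ ≤ _ := by gcongr
  have key := eq_zero_along_ray hU hXC hC0 hC (q := q) (v := v)
    (fun i => by
      have h := PiLp.norm_apply_le v i
      rwa [hvn] at h) (T := T) (s := 1) (N := B / η ^ 3) one_pos hCT
    (fun t ht => ⟨hRU (hpath t ht), by
      have h1 := hlow _ (hpath t ht)
      linarith [ht.2]⟩)
    (fun t ht => by
      have hK' := hpath t ht
      rcases lt_or_ge t η with htη | htη
      · have h0 := hnear t ht htη
        have h1 : ∀ k i, pd i (vecComp X e k) =ᶠ[𝓝 (q + t • v)] fun _ => 0 := fun k i => by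
          filter_upwards [(h0 k).eventuallyEq_nhds] with y hy
          rw [pd_congr hy, hpd0]
        refine ⟨fun k => ?_, fun k i => ?_, fun k i j => ?_⟩
        · rw [(h0 k).self_of_nhds, abs_zero]
          exact mul_nonneg hN0 (Real.rpow_nonneg ht.1.le _)
        · rw [(h1 k i).self_of_nhds, abs_zero]
          exact mul_nonneg hN0 (Real.rpow_nonneg ht.1.le _)
        · rw [pd_congr (h1 k j), hpd0, abs_zero]
          exact mul_nonneg hN0 (Real.rpow_nonneg ht.1.le _)
      · refine ⟨fun k => ?_, fun k i => ?_, fun k i j => ?_⟩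
        · exact ((hB₀ k _ hK').trans (le_max_left _ _)).trans (hfar t ht htη _ (by norm_num))
        · exact ((hB₁ (i, k) _ hK').trans ((le_max_left _ _).trans (le_max_right _ _))).trans
            (hfar t ht htη _ (by norm_num))
        · exact ((hB₂ (i, j, k) _ hK').trans ((le_max_right _ _).trans (le_max_right _ _))).trans
            (hfar t ht htη _ (by norm_num)))
    (dist x q) ⟨hd0, hdT⟩ k
  have hxq' : q + dist x q • v = x := by
    simp only [v]
    rw [smul_smul, mul_inv_cancel₀ hd0.ne', one_smul]
    abel
  rwa [hxq'] at key

end Manifold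

end WeakAH

end

theorem mainTheorem5
    (Mbar : Type*) [TopologicalSpace Mbar] [T2Space Mbar] [CompactSpace Mbar]
    [ChartedSpace (EuclideanHalfSpace 3) Mbar] [IsManifold (𝓡∂ 3) ∞ Mbar]
    (hboundary : ∀ p : Mbar, ∃ q ∈ (𝓡∂ 3).boundary Mbar, q ∈ connectedComponent p)
    (ρ : Mbar → ℝ) (hρ : WeakAH.IsDefiningFunction ρ)
    (hbar : WeakAH.SmoothMetric Mbar)
    (h_unit : ∀ p ∈ (𝓡∂ 3).boundary Mbar, WeakAH.dNorm ρ p (hbar.inner p) = 1)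
    (α : ℝ) (hα₀ : 0 < α) (hα₁ : α < 1)
    (lam : WeakAH.BilinField Mbar) (hlam : WeakAH.IsWeaklyAH ρ hbar 3 α lam)
    (δ : ℝ) (hδ : 1 < δ)
    (X : WeakAH.VField Mbar) (hX : WeakAH.VectorHolder ρ 3 α δ X)
    (hXK : WeakAH.IsConformalKilling lam X) :
    ∀ p ∈ (𝓡∂ 3).interior Mbar, X p = 0 := by
  let W : Set Mbar := {p | ∀ᶠ q in 𝓝 p, q ∈ (𝓡∂ 3).interior Mbar → X q = 0}
  have hopen : IsOpen W := isOpen_iff_mem_nhds.2 fun p hp => eventually_eventually_nhds.2 hp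
  -- a neighbourhood of `p` from a ball in the chart
  have hball : ∀ (p : Mbar) (ε : ℝ), 0 < ε → ∀ᶠ q in 𝓝 p, q ∈ (chartAt WeakAH.H3 p).source ∧
      extChartAt (𝓡∂ 3) p q ∈ Metric.ball (extChartAt (𝓡∂ 3) p p) ε := fun p ε hε =>
    Filter.Eventually.and ((chartAt WeakAH.H3 p).open_source.mem_nhds (mem_chart_source _ p))
      ((continuousAt_extChartAt p).eventually (Metric.ball_mem_nhds _ hε))
  have hinv : ∀ (p q : Mbar), q ∈ (chartAt WeakAH.H3 p).source →
      extChartAt (𝓡∂ 3) p q ∈ ((chartAt WeakAH.H3 p).extend (𝓡∂ 3)).target ∧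
      WeakAH.chartPoint (chartAt WeakAH.H3 p) (extChartAt (𝓡∂ 3) p q) = q := fun p q hq => by
    rw [← extChartAt_source (𝓡∂ 3)] at hq
    exact ⟨(extChartAt (𝓡∂ 3) p).map_source hq, (extChartAt (𝓡∂ 3) p).left_inv hq⟩
  have hbdry : ∀ p ∈ (𝓡∂ 3).boundary Mbar, p ∈ W := by
    intro p hp
    obtain ⟨ε, hε, h0⟩ := WeakAH.exists_halfBall_eq_zero_of_boundary hρ hlam hδ hX hXK hp
    filter_upwards [hball p ε hε] with q hq hqi
    obtain ⟨hT, hqq⟩ := hinv p q hq.1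
    have h := (WeakAH.vecComp_eq_zero_iff hT).1 (h0 _ ⟨hq.2,
      (WeakAH.chartPoint_mem_interior_iff hT).1 (by rwa [hqq])⟩)
    rwa [hqq] at h
  have hclosed : IsClosed W := by
    refine isClosed_of_closure_subset fun p hp => ?_
    by_cases hpb : p ∈ (𝓡∂ 3).boundary Mbar
    · exact hbdry p hpb
    rw [← Set.mem_compl_iff, ModelWithCorners.compl_boundary] at hpb
    obtain ⟨ε, hε, hsub, huc⟩ := WeakAH.exists_ball_unique_continuation hρ hlam hX hXK hpb
    obtain ⟨q, hqW, hqs, hqb⟩ := ((mem_closure_iff_frequently.1 hp).and_eventually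
      (hball p ε hε)).exists
    obtain ⟨hT, hqq⟩ := hinv p q hqs
    have hzero : ∀ᶠ y in 𝓝 (extChartAt (𝓡∂ 3) p q), ∀ k,
        WeakAH.vecComp X (chartAt WeakAH.H3 p) k y = 0 := by
      have hcont : ContinuousAt (WeakAH.chartPoint (chartAt WeakAH.H3 p))
          (extChartAt (𝓡∂ 3) p q) := continuousAt_extChartAt_symm'' hT
      have hW : ∀ᶠ q' in 𝓝 (WeakAH.chartPoint (chartAt WeakAH.H3 p) (extChartAt (𝓡∂ 3) p q)),
          q' ∈ (𝓡∂ 3).interior Mbar → X q' = 0 := by rw [hqq]; exact hqW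
      filter_upwards [hcont.eventually hW,
        (WeakAH.isOpen_chartInterior (chartAt WeakAH.H3 p)).mem_nhds (hsub hqb)] with y hy hyi
      exact (WeakAH.vecComp_eq_zero_iff hyi.1).2
        (hy ((WeakAH.chartPoint_mem_interior_iff hyi.1).2 hyi.2))
    filter_upwards [hball p ε hε] with q' hq' _
    obtain ⟨hT', hqq'⟩ := hinv p q' hq'.1
    have h := (WeakAH.vecComp_eq_zero_iff hT').1 (huc _ hqb hzero _ hq'.2)
    rwa [hqq'] at h
  intro p hp
  obtain ⟨q, hqb, hqp⟩ := hboundary p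
  have hsub := (show IsClopen W from ⟨hclosed, hopen⟩).connectedComponent_subset (hbdry q hqb)
  have hpW : p ∈ W := hsub (by rw [← connectedComponent_eq hqp]; exact mem_connectedComponent)
  exact hpW.self_of_nhds hp
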